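/- \textbf{Setting.} Let $\Lambda$ be a finite metric space (the lattice) which is at most $D$-dimensional with constant $\kappa$: every ball of radius $r\ge 0$ contains at most $\kappa(1+r)^D$ sites. Each site $u$ carries a Hilbert space $\mathbb{C}^{q_u}$, $1\le q_u<\infty$, and operators act on $\bigotimes_{u\in\Lambda}\mathbb{C}^{q_u}$; an operator is supported on $A\subseteq\Lambda$ if it is of the form $m\otimes 1$ with $m$ acting on the sites of $A$. Let $H_0=\sum_{Z\subseteq\Lambda}H_{0,Z}$ and $V=\sum_{Z\subseteq\Lambda}V_Z$ be Hermitian, where $H_{0,Z}$ and $V_Z$ are supported on $Z$ and, for all $u\in\Lambda$, $$\sum_{Z\ni u}\|H_{0,Z}\|\,|Z|\,e^{\mu\,\mathrm{diam}(Z)}\le K,\qquad \sum_{Z\ni u}\|V_Z\|\,|Z|\,e^{\mu\,\mathrm{diam}(Z)}\le J, \qquad (*)$$ with constants $\mu,J,K>0$. Let $F:\mathbb{R}\to\mathbb{C}$ be an integrable function with $F(-t)=-F(t)$ whose Fourier transform $\tilde F(\omega)=\int F(t)e^{i\omega t}\,dt$ is real-valued and infinitely differentiable and satisfies $\tilde F(\omega)=-1/\omega$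 for $|\omega|\ge 1/2$. Put $H_s=H_0+sV$, $$\mathcal{D}_s=i\int F(t)\,e^{iH_st}\,(\partial_sH_s)\,e^{-iH_st}\,dt,$$ and let $U_s=\mathcal{S}'\exp\bigl\{i\int_0^s\mathcal{D}_{s'}\,ds'\bigr\}$ be the $s'$-ordered exponential (so that $\partial_sU_s=i\mathcal{D}_sU_s$, $U_0=1$). Write $\mathrm{dist}(A,B)=\min_{x\in A,\,y\in B}\mathrm{dist}(x,y)$. \textbf{Lemma.} For given $F,D,\kappa,\mu,J,K$ there are a constant $C$ and functions $h,h'$ on $\mathbb{R}$ that decay faster than any negative power ($l^nh(l)\to0$ and $l^nh'(l)\to 0$ as $l\to\infty$, for every $n\in\mathbb{N}$) such that the following holds for all $\Lambda$, $(q_u)$, $H_0$, $V$ as above and all $0\le s\le1$. (1) For all $A,B\subseteq\Lambda$, all $O_A$ supported on $A$ and all $O_B$ supported on $B$, $$\|[U_sO_AU_s^\dagger,O_B]\|\le h(\mathrm{dist}(A,B))\,|A|\,\|O_A\|\,\|O_B\|,\qquad \|[U_s^\dagger O_AU_s,O_B]\|\le h(\mathrm{dist}(A,B))\,|A|\,\|O_A\|\,\|O_B\|.$$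 (2) There are operators $\mathcal{D}_s(Z)$, $Z\subseteq\Lambda$, with $\mathcal{D}_s=\sum_Z\mathcal{D}_s(Z)$ and $\|\mathcal{D}_s(Z)\|\le C\,\|V_Z\|$ for every $Z$, and such that, for all $Z,B\subseteq\Lambda$ and all $O_B$ supported on $B$, $$\|[\mathcal{D}_s(Z),O_B]\|\le h'(\mathrm{dist}(Z,B))\,|Z|\,\|V_Z\|\,\|O_B\|.$$ -/

import Mathlib

open Filter MeasureTheory


noncomputable section

namespace QuasiAdiabatic

/-- The many-body Hilbert space `⨂_{u ∈ Λ} ℂ^{q u}`, realised as the Euclidean space on the product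
basis: basis vectors are the configurations `σ : ∀ u, Fin (q u)`. -/
abbrev Hilb {Λ : Type*} [Fintype Λ] [DecidableEq Λ] (q : Λ → ℕ) : Type _ :=
  EuclideanSpace ℂ (∀ u : Λ, Fin (q u))

/-- Operators on the many-body Hilbert space, with the operator norm; `star` is the adjoint. -/
abbrev Op {Λ : Type*} [Fintype Λ] [DecidableEq Λ] (q : Λ → ℕ) : Type _ :=
  Hilb q →L[ℂ] Hilb q

section Lattice

variable {Λ : Type*} [Fintype Λ] [DecidableEq Λ]

/-- The matrix element `⟨σ| O |τ⟩` in the product basis. -/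
def entry {q : Λ → ℕ} (O : Op q) (σ τ : ∀ u : Λ, Fin (q u)) : ℂ :=
  O (EuclideanSpace.single τ 1) σ

/-- `O` is supported on `A`: it has the form `m ⊗ 1` with `m` acting on the sites of `A` and `1`
the identity on the sites outside `A`. -/
def SupportedOn {q : Λ → ℕ} (A : Finset Λ) (O : Op q) : Prop :=
  ∃ m : (∀ u : A, Fin (q u)) → (∀ u : A, Fin (q u)) → ℂ,
    ∀ σ τ : ∀ u : Λ, Fin (q u),
      entry O σ τ = if ∀ u, u ∉ A → σ u = τ u then m (fun u => σ u) (fun u => τ u) else 0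

/-- `dist(A, B) = min {dist x y : x ∈ A, y ∈ B}` (with value `0` if `A` or `B` is empty). -/
def setDist [MetricSpace Λ] (A B : Finset Λ) : ℝ :=
  sInf {r : ℝ | ∃ x ∈ A, ∃ y ∈ B, r = dist x y}

/-- The family `Φ` of operators `Φ Z`, `Z ⊆ Λ`, is a decomposition of a Hamiltonian `∑ Z, Φ Z` into
local terms whose strength decays exponentially at rate `μ`, with constant `K`. -/
structure IsLocalDecomposition [MetricSpace Λ] {q : Λ → ℕ} (μ K : ℝ)
    (Φ : Finset Λ → Op q) : Prop where
  supported : ∀ Z, SupportedOn Z (Φ Z)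
  selfAdjoint : IsSelfAdjoint (∑ Z, Φ Z)
  decay : ∀ u : Λ, ∑ Z with u ∈ Z,
    ‖Φ Z‖ * (Z.card : ℝ) * Real.exp (μ * Metric.diam (Z : Set Λ)) ≤ K

/-- The finite metric space `Λ` is a lattice of dimension (at most) `D`, with constant `κ`: the
number of sites in a ball of radius `r` is at most `κ (1 + r) ^ D`. -/
def HasDimension (Λ : Type*) [Fintype Λ] [MetricSpace Λ] (D : ℕ) (κ : ℝ) : Prop :=
  ∀ (u : Λ) (r : ℝ), 0 ≤ r → (Nat.card {v : Λ // dist u v ≤ r} : ℝ) ≤ κ * (1 + r) ^ D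

/-- The Hamiltonian path `H_s = H₀ + s V`, for `H₀ = ∑ Z, H₀ Z` and `V = ∑ Z, V Z`. -/
def path {q : Λ → ℕ} (H₀ V : Finset Λ → Op q) (s : ℝ) : Op q :=
  (∑ Z, H₀ Z) + s • ∑ Z, V Z

/-- The generator `D_s = i ∫ F(t) exp(i H_s t) (∂_s H_s) exp(-i H_s t) dt`. -/
def generator {q : Λ → ℕ} (F : ℝ → ℂ) (H : ℝ → Op q) (s : ℝ) : Op q :=
  Complex.I • ∫ t : ℝ, F t • (NormedSpace.exp ((Complex.I * (t : ℂ)) • H s) * deriv H s *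
    NormedSpace.exp (-((Complex.I * (t : ℂ)) • H s)))

/-- The `n`-th term of the Dyson series,
`i ^ n ∫_{s ≥ s₁ ≥ ⋯ ≥ sₙ ≥ 0} D_{s₁} ⋯ D_{sₙ}`. -/
def dysonTerm {q : Λ → ℕ} (D : ℝ → Op q) : ℕ → ℝ → Op q
  | 0, _ => 1
  | n + 1, s => ∫ r in (0 : ℝ)..s, Complex.I • (D r * dysonTerm D n r)

/-- The ordered exponential of `i ∫_0^s D_r dr` (later parameters to the left). -/
def orderedExp {q : Λ → ℕ} (D : ℝ → Op q) (s : ℝ) : Op q :=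
  ∑' n : ℕ, dysonTerm D n s

/-- The quasi-adiabatic continuation operator `U_s` of the path `H_s = H₀ + s V`. -/
def continuation {q : Λ → ℕ} (F : ℝ → ℂ) (H₀ V : Finset Λ → Op q) (s : ℝ) : Op q :=
  orderedExp (generator F (path H₀ V)) s

end Lattice

/-- Filter functions: `F` is integrable and odd, and its Fourier transform
`∫ F(t) exp(i ω t) dt` is a real-valued smooth function that equals `-1/ω` for `|ω| ≥ 1/2`. -/
structure IsFilterFunction (F : ℝ → ℂ) : Prop where
  integrable : Integrable F
  odd : ∀ t, F (-t) = -F t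
  fourier : ∃ g : ℝ → ℝ, ContDiff ℝ (⊤ : ℕ∞) g ∧
    (∀ ω : ℝ, ∫ t : ℝ, F t * Complex.exp (Complex.I * (ω : ℂ) * (t : ℂ)) = (g ω : ℂ)) ∧
    ∀ ω : ℝ, 1 / 2 ≤ |ω| → g ω = -1 / ω

end QuasiAdiabatic

end

/-!
# Locality of quasi-adiabatic continuation

The argument combines three ingredients.

*A Lieb-Robinson bound with abstract weights* (`lieb_robinson`). Let `U` solve
`∂ₛ U = i (∑ᵢ Φ s i) U` and let `f(s) = [U⋆ O U, P]` with `O` supported on `A`. Only the terms that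
meet `A` contribute to `∂ₛ (U⋆ O U)`, and by the Jacobi identity `∂ₛ f = i [E, f] + R`, where `E` is
self-adjoint and `‖R‖ ≤ 2 ‖O‖ ∑ ‖[U⋆ Φ s i U, P]‖`, the sum being over the terms that meet `A`. The
first part does not change the norm (`norm_le_of_hasDerivAt_lie_add`), so a bound for the terms
`Φ s i` yields one for `O`. If a weight `G(A)` is reproduced by the interaction,
`∑ ‖Φ s i‖ G(supp i) ≤ c G(A)`, the integrated inequality improves any bound
`S · 2 exp(4cs) G(A) ‖O‖ ‖P‖` to the one with `1 + S / 2` in place of `S`, and iteration starting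
from the trivial bound gives `S = 2`.

*Decay of the filter function* (`IsFilterFunction.integrable_pow`). All derivatives of order at
least two of the Fourier transform of `F` are integrable, because it equals `-1/ω` for large `ω`.
Testing against Schwartz functions shows that `t ^ n F(t)` is bounded for `n ≥ 2`, so all moments
of `F` are finite. Moreover `F`, being odd with a real Fourier transform, is purely imaginary, so
that the generator is self-adjoint. Integrating the Lieb-Robinson bound for `H_s`, with the weight
`∑_{x ∈ A} exp(-μ d(x, B))`, against `F` shows that the terms
`i ∫ F(t) exp(i H_s t) V_Z exp(-i H_s t) dt` of the generator are local up to tails that decay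
faster than any power (`exists_norm_lie_dressed_le`).

*Resummation.* Each term of the generator is cut into annular parts, supported on the fattenings of
`Z`, by averaging over signed permutations of the configurations outside (`localize`). The parts
form an interaction that decays like any power `(1 + d(x, y)) ^ (-p)`. On a lattice of dimension
`D` the weight `∑_{x ∈ A} ∑_{y ∈ B} (1 + d(x, y)) ^ (-p)` is reproduced by such an interaction as
soon as `p ≥ D + 2`, so the abstract bound applies again
(`exists_norm_lie_continuation_le`). This weight is symmetric in `A` and `B`, which is why both
`U O U⋆` and `U⋆ O U` obey a bound with the factor `|A|`.

All constants are uniform in the system; the functions `h` and `h'` are infima over `n` of the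
bounds of order `n` (`exists_superpolynomialDecay`).
-/

noncomputable section

namespace QuasiAdiabatic

/-! ### Matrix elements and supports -/

section Support

variable {Λ : Type*} [Fintype Λ] [DecidableEq Λ] {q : Λ → ℕ}

/-- The operator with a given matrix in the product basis. -/
def ofMatrix (M : Matrix (∀ u : Λ, Fin (q u)) (∀ u : Λ, Fin (q u)) ℂ) : Op q :=
  Matrix.toEuclideanCLM (𝕜 := ℂ) M

theorem entry_ofMatrix (M : Matrix (∀ u : Λ, Fin (q u)) (∀ u : Λ, Fin (q u)) ℂ)
    (σ τ : ∀ u : Λ, Fin (q u)) : entry (ofMatrix M) σ τ = M σ τ := by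
  simp [entry, ofMatrix]

theorem exists_ofMatrix (O : Op q) : ∃ M, ofMatrix M = O :=
  (Matrix.toEuclideanCLM (n := ∀ u : Λ, Fin (q u)) (𝕜 := ℂ)).surjective O

theorem ofMatrix_one :
    ofMatrix (1 : Matrix (∀ u : Λ, Fin (q u)) (∀ u : Λ, Fin (q u)) ℂ) = 1 :=
  map_one (Matrix.toEuclideanCLM (n := ∀ u : Λ, Fin (q u)) (𝕜 := ℂ))

theorem ofMatrix_mul (M N : Matrix (∀ u : Λ, Fin (q u)) (∀ u : Λ, Fin (q u)) ℂ) :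
    ofMatrix (M * N) = ofMatrix M * ofMatrix N :=
  map_mul (Matrix.toEuclideanCLM (n := ∀ u : Λ, Fin (q u)) (𝕜 := ℂ)) M N

theorem ofMatrix_star (M : Matrix (∀ u : Λ, Fin (q u)) (∀ u : Λ, Fin (q u)) ℂ) :
    ofMatrix (star M) = star (ofMatrix M) :=
  (Matrix.toEuclideanCLM (n := ∀ u : Λ, Fin (q u)) (𝕜 := ℂ)).map_star' M

theorem op_ext {O P : Op q} (h : ∀ σ τ, entry O σ τ = entry P σ τ) : O = P := by
  obtain ⟨M, rfl⟩ := exists_ofMatrix O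
  obtain ⟨N, rfl⟩ := exists_ofMatrix P
  congr 1
  refine Matrix.ext fun σ τ => ?_
  simpa only [entry_ofMatrix] using h σ τ

theorem entry_mul (O P : Op q) (σ τ : ∀ u : Λ, Fin (q u)) :
    entry (O * P) σ τ = ∑ ρ, entry O σ ρ * entry P ρ τ := by
  obtain ⟨M, rfl⟩ := exists_ofMatrix O
  obtain ⟨N, rfl⟩ := exists_ofMatrix P
  simp only [← ofMatrix_mul, entry_ofMatrix, Matrix.mul_apply]

theorem entry_star (O : Op q) (σ τ : ∀ u : Λ, Fin (q u)) :
    entry (star O) σ τ = star (entry O τ σ) := by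
  obtain ⟨M, rfl⟩ := exists_ofMatrix O
  rw [← ofMatrix_star, entry_ofMatrix, entry_ofMatrix, Matrix.star_apply]

theorem entry_one (σ τ : ∀ u : Λ, Fin (q u)) :
    entry (1 : Op q) σ τ = if σ = τ then 1 else 0 := by
  rw [← ofMatrix_one, entry_ofMatrix, Matrix.one_apply]

theorem entry_add (O P : Op q) (σ τ : ∀ u : Λ, Fin (q u)) :
    entry (O + P) σ τ = entry O σ τ + entry P σ τ := by
  simp [entry]

theorem entry_smul (c : ℂ) (O : Op q) (σ τ : ∀ u : Λ, Fin (q u)) :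
    entry (c • O) σ τ = c * entry O σ τ := by
  simp [entry]

theorem entry_sum {ι : Type*} (s : Finset ι) (O : ι → Op q) (σ τ : ∀ u : Λ, Fin (q u)) :
    entry (∑ i ∈ s, O i) σ τ = ∑ i ∈ s, entry (O i) σ τ := by
  simp [entry]

/-- An operator is supported on `A` if and only if its matrix elements vanish between
configurations that differ off `A` and do not depend on the common part off `A`. -/
theorem supportedOn_iff {A : Finset Λ} {O : Op q} :
    SupportedOn A O ↔
      (∀ σ τ, (∃ u, u ∉ A ∧ σ u ≠ τ u) → entry O σ τ = 0) ∧
      ∀ σ τ σ' τ', (∀ u ∈ A, σ u = σ' u) → (∀ u ∈ A, τ u = τ' u) →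
        (∀ u, u ∉ A → σ u = τ u) → (∀ u, u ∉ A → σ' u = τ' u) →
        entry O σ τ = entry O σ' τ' := by
  constructor
  · rintro ⟨m, hm⟩
    refine ⟨fun σ τ ⟨u, hu, hne⟩ => ?_, fun σ τ σ' τ' h1 h2 h3 h4 => ?_⟩
    · rw [hm, if_neg fun h => hne (h u hu)]
    · rw [hm, hm, if_pos h3, if_pos h4]
      congr 1 <;> funext u
      exacts [h1 u u.2, h2 u u.2]
  · rintro ⟨h1, h2⟩
    rcases isEmpty_or_nonempty (∀ u : Λ, Fin (q u)) with he | ⟨⟨ρ⟩⟩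
    · exact ⟨fun _ _ => 0, fun σ => (he.false σ).elim⟩
    · refine ⟨fun a b => entry O (fun u => if h : u ∈ A then a ⟨u, h⟩ else ρ u)
        (fun u => if h : u ∈ A then b ⟨u, h⟩ else ρ u), fun σ τ => ?_⟩
      split_ifs with h
      · apply h2 _ _ _ _ _ _ h
        · intro u hu; simp [hu]
        · intro u hu; simp [hu]
        · intro u hu; simp [hu]
      · push Not at h
        exact h1 _ _ h

theorem SupportedOn.add {A : Finset Λ} {O P : Op q} (hO : SupportedOn A O)
    (hP : SupportedOn A P) : SupportedOn A (O + P) := by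
  rw [supportedOn_iff] at *
  refine ⟨fun σ τ h => ?_, fun σ τ σ' τ' a b c d => ?_⟩
  · rw [entry_add, hO.1 _ _ h, hP.1 _ _ h, add_zero]
  · rw [entry_add, entry_add, hO.2 _ _ _ _ a b c d, hP.2 _ _ _ _ a b c d]

theorem SupportedOn.smul {A : Finset Λ} {O : Op q} (hO : SupportedOn A O) (c : ℂ) :
    SupportedOn A (c • O) := by
  rw [supportedOn_iff] at *
  refine ⟨fun σ τ h => ?_, fun σ τ σ' τ' a b e d => ?_⟩
  · rw [entry_smul, hO.1 _ _ h, mul_zero]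
  · rw [entry_smul, entry_smul, hO.2 _ _ _ _ a b e d]

theorem SupportedOn.sub {A : Finset Λ} {O P : Op q} (hO : SupportedOn A O)
    (hP : SupportedOn A P) : SupportedOn A (O - P) := by
  have h : O - P = O + (-1 : ℂ) • P := by
    rw [sub_eq_add_neg]
    congr 1
    exact (neg_one_smul ℂ P).symm
  exact h ▸ hO.add (hP.smul (-1))

theorem SupportedOn.star {A : Finset Λ} {O : Op q} (hO : SupportedOn A O) :
    SupportedOn A (star O) := by
  rw [supportedOn_iff] at *
  refine ⟨fun σ τ ⟨u, hu, hne⟩ => ?_, fun σ τ σ' τ' a b c d => ?_⟩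
  · rw [entry_star, hO.1 _ _ ⟨u, hu, hne.symm⟩, star_zero]
  · rw [entry_star, entry_star,
      hO.2 _ _ _ _ b a (fun u hu => (c u hu).symm) (fun u hu => (d u hu).symm)]

theorem SupportedOn.mono {A B : Finset Λ} {O : Op q} (hO : SupportedOn A O) (h : A ⊆ B) :
    SupportedOn B O := by
  rw [supportedOn_iff] at *
  refine ⟨fun σ τ ⟨u, hu, hne⟩ => hO.1 _ _ ⟨u, fun hA => hu (h hA), hne⟩,
    fun σ τ σ' τ' a b c d => ?_⟩
  by_cases hst : ∀ u, u ∉ A → σ u = τ u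
  · refine hO.2 _ _ _ _ (fun u hu => a u (h hu)) (fun u hu => b u (h hu)) hst fun u hu => ?_
    by_cases huB : u ∈ B
    · rw [← a u huB, ← b u huB, hst u hu]
    · exact d u huB
  · push Not at hst
    obtain ⟨u, hu, hne⟩ := hst
    have huB : u ∈ B := by
      by_contra hB
      exact hne (c u hB)
    rw [hO.1 _ _ ⟨u, hu, hne⟩, hO.1 _ _ ⟨u, hu, by rwa [← a u huB, ← b u huB]⟩]

theorem supportedOn_univ (O : Op q) : SupportedOn Finset.univ O := by
  rw [supportedOn_iff]
  refine ⟨fun σ τ ⟨u, hu, _⟩ => (hu (Finset.mem_univ u)).elim, fun σ τ σ' τ' a b _ _ => ?_⟩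
  rw [funext fun u => a u (Finset.mem_univ u), funext fun u => b u (Finset.mem_univ u)]

theorem SupportedOn.mul_comm {A B : Finset Λ} {O P : Op q} (hO : SupportedOn A O)
    (hP : SupportedOn B P) (hAB : Disjoint A B) : O * P = P * O := by
  rw [supportedOn_iff] at hO hP
  have hd : ∀ u, u ∈ A → u ∉ B := fun u h h' => Finset.disjoint_left.1 hAB h h'
  refine op_ext fun σ τ => ?_
  -- In both products a single intermediate configuration contributes.
  rw [entry_mul, entry_mul,
    Finset.sum_eq_single (fun u => if u ∈ A then τ u else σ u),
    Finset.sum_eq_single (fun u => if u ∈ A then σ u else τ u)]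
  · rw [_root_.mul_comm]
    congr 1
    · by_cases h : ∃ u, u ∉ A ∧ u ∉ B ∧ σ u ≠ τ u
      · obtain ⟨u, hA, hB, hne⟩ := h
        rw [hP.1 _ _ ⟨u, hB, by simpa [hA] using hne⟩, hP.1 _ _ ⟨u, hB, by simpa [hA] using hne⟩]
      · push Not at h
        apply hP.2
        · intro u hu
          simp [show u ∉ A from fun hA => hd u hA hu]
        · intro u hu
          simp [show u ∉ A from fun hA => hd u hA hu]
        · intro u hu
          by_cases hA : u ∈ A
          · simp [hA]
          · simpa [hA] using h u hA hu
        · intro u hu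
          by_cases hA : u ∈ A
          · simp [hA]
          · simpa [hA] using h u hA hu
    · apply hO.2 <;> intro u hu <;> simp [hu]
  · intro ρ _ hρ
    by_contra hne
    apply hρ
    funext u
    by_cases hA : u ∈ A
    · rw [if_pos hA]
      by_contra h
      exact hne (by rw [hP.1 _ _ ⟨u, hd u hA, Ne.symm h⟩, zero_mul])
    · rw [if_neg hA]
      by_contra h
      exact hne (by rw [hO.1 _ _ ⟨u, hA, h⟩, mul_zero])
  · simp
  · intro ρ _ hρ
    by_contra hne
    apply hρ
    funext u
    by_cases hA : u ∈ A
    · rw [if_pos hA]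
      by_contra h
      exact hne (by rw [hP.1 _ _ ⟨u, hd u hA, h⟩, mul_zero])
    · rw [if_neg hA]
      by_contra h
      exact hne (by rw [hO.1 _ _ ⟨u, hA, Ne.symm h⟩, zero_mul])
  · simp

theorem SupportedOn.lie_eq_zero {A B : Finset Λ} {O P : Op q} (hO : SupportedOn A O)
    (hP : SupportedOn B P) (hAB : Disjoint A B) : ⁅O, P⁆ = 0 := by
  rw [Ring.lie_def, hO.mul_comm hP hAB, sub_self]

/-! ### Localization by averaging over signed permutations -/

/-- Configurations of the sites outside `A`. -/
abbrev OffConfig (q : Λ → ℕ) (A : Finset Λ) : Type _ := ∀ u : {u : Λ // u ∉ A}, Fin (q u)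

/-- The map on configurations that applies `π` to the part outside `A`. -/
def actOff {A : Finset Λ} (π : OffConfig q A → OffConfig q A) (σ : ∀ u : Λ, Fin (q u)) :
    ∀ u : Λ, Fin (q u) :=
  fun u => if h : u ∈ A then σ u else π (fun v => σ v.1) ⟨u, h⟩

omit [Fintype Λ] in
theorem actOff_eq_iff {A : Finset Λ} (π : OffConfig q A → OffConfig q A)
    (σ τ : ∀ u : Λ, Fin (q u)) :
    τ = actOff π σ ↔ (∀ u ∈ A, σ u = τ u) ∧
      (fun v : {u : Λ // u ∉ A} => τ v.1) = π (fun v => σ v.1) := by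
  constructor
  · rintro rfl
    refine ⟨fun u hu => by simp [actOff, hu], ?_⟩
    funext v
    simp [actOff, v.2]
  · rintro ⟨h1, h2⟩
    funext u
    by_cases hu : u ∈ A
    · simp [actOff, hu, h1 u hu]
    · simp only [actOff, hu, dite_false]
      exact congrFun h2 ⟨u, hu⟩

/-- The signed permutation operator on the sites outside `A`, for signs `g.1` and a
permutation `g.2` of the configurations outside `A`. -/
def signedPerm (A : Finset Λ) (g : (OffConfig q A → ℤˣ) × Equiv.Perm (OffConfig q A)) : Op q :=
  ofMatrix (Matrix.of fun σ τ =>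
    if τ = actOff g.2 σ then (((g.1 fun v => τ v.1 : ℤˣ) : ℤ) : ℂ) else 0)

theorem entry_signedPerm {A : Finset Λ}
    (g : (OffConfig q A → ℤˣ) × Equiv.Perm (OffConfig q A)) (σ τ : ∀ u : Λ, Fin (q u)) :
    entry (signedPerm A g) σ τ =
      if τ = actOff g.2 σ then (((g.1 fun v => τ v.1 : ℤˣ) : ℤ) : ℂ) else 0 :=
  entry_ofMatrix _ σ τ

theorem entry_signedPerm_mul {A : Finset Λ}
    (g : (OffConfig q A → ℤˣ) × Equiv.Perm (OffConfig q A)) (O : Op q) (σ τ) :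
    entry (signedPerm A g * O) σ τ =
      (((g.1 (g.2 fun v => σ v.1) : ℤˣ) : ℤ) : ℂ) * entry O (actOff g.2 σ) τ := by
  rw [entry_mul, Finset.sum_eq_single (actOff g.2 σ)]
  · rw [entry_signedPerm, if_pos rfl, ((actOff_eq_iff _ _ _).1 rfl).2]
  · intro ρ _ h
    rw [entry_signedPerm, if_neg h, zero_mul]
  · simp

theorem entry_signedPerm_conj {A : Finset Λ}
    (g : (OffConfig q A → ℤˣ) × Equiv.Perm (OffConfig q A)) (O : Op q) (σ τ) :
    entry (signedPerm A g * O * star (signedPerm A g)) σ τ =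
      (((g.1 (g.2 fun v => σ v.1) * g.1 (g.2 fun v => τ v.1) : ℤˣ) : ℤ) : ℂ) *
        entry O (actOff g.2 σ) (actOff g.2 τ) := by
  have : signedPerm A g * O * star (signedPerm A g) =
      signedPerm A g * star (signedPerm A g * star O) := by
    rw [star_mul, star_star, mul_assoc]
  rw [this, entry_signedPerm_mul, entry_star, entry_signedPerm_mul, entry_star, star_mul', star_star]
  push_cast
  simp
  ring

theorem signedPerm_mul_star (A : Finset Λ)
    (g : (OffConfig q A → ℤˣ) × Equiv.Perm (OffConfig q A)) :
    signedPerm A g * star (signedPerm A g) = 1 := by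
  have := fun σ τ => entry_signedPerm_conj g 1 σ τ
  rw [mul_one] at this
  refine op_ext fun σ τ => ?_
  rw [this, entry_one, entry_one]
  by_cases h : σ = τ
  · subst h
    simp
  · rw [if_neg h, if_neg, mul_zero]
    intro h'
    apply h
    obtain ⟨a, b⟩ := (actOff_eq_iff _ _ _).1 h'
    funext u
    by_cases hu : u ∈ A
    · rw [a u hu]
      simp [actOff, hu]
    · have e := ((actOff_eq_iff g.2 σ _).1 rfl).2
      rw [e] at b
      exact congrFun (g.2.injective b) ⟨u, hu⟩

theorem supportedOn_signedPerm (A : Finset Λ)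
    (g : (OffConfig q A → ℤˣ) × Equiv.Perm (OffConfig q A)) :
    SupportedOn Aᶜ (signedPerm A g) := by
  rw [supportedOn_iff]
  simp only [entry_signedPerm, Finset.mem_compl, not_not, actOff_eq_iff]
  refine ⟨fun σ τ ⟨u, hu, hne⟩ => if_neg fun h => hne (h.1 u hu),
    fun σ τ σ' τ' a b c d => ?_⟩
  have ha : (fun v : {u : Λ // u ∉ A} => σ v) =
        (fun v : {u : Λ // u ∉ A} => σ' v) := funext fun v => a v v.2
  have hb : (fun v : {u : Λ // u ∉ A} => τ v) =
        (fun v : {u : Λ // u ∉ A} => τ' v) := funext fun v => b v v.2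
  rw [ha, hb]
  exact if_congr (and_congr_left' ⟨fun _ => d, fun _ => c⟩) rfl rfl

/-- The localization of an operator to `A`: its average over conjugations by the signed
permutations of the basis outside `A`. It equals the normalized partial trace over the sites
outside `A`. -/
def localize (A : Finset Λ) (O : Op q) : Op q :=
  (Fintype.card ((OffConfig q A → ℤˣ) × Equiv.Perm (OffConfig q A)) : ℂ)⁻¹ •
    ∑ g : (OffConfig q A → ℤˣ) × Equiv.Perm (OffConfig q A),
      signedPerm A g * O * star (signedPerm A g)

theorem supportedOn_localize (A : Finset Λ) (O : Op q) : SupportedOn A (localize A O) := by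
  rw [supportedOn_iff]
  refine ⟨fun σ τ ⟨u, hu, hne⟩ => ?_, fun σ τ σ' τ' a b c d => ?_⟩
  · rw [localize, entry_smul, entry_sum, Fintype.sum_prod_type_right]
    simp only [entry_signedPerm_conj]
    rw [Finset.sum_eq_zero, mul_zero]
    intro π _
    -- Flipping the sign at the image of `σ` changes the sign of the sum over all sign patterns.
    have hne' : π (fun v => σ v.1) ≠ π (fun v => τ v.1) := fun h =>
      hne (congrFun (π.injective h) ⟨u, hu⟩)
    set S := ∑ ε : OffConfig q A → ℤˣ, (((ε (π fun v => σ v.1) * ε (π fun v => τ v.1) : ℤˣ) : ℤ) : ℂ) *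
        entry O (actOff π σ) (actOff π τ) with hS
    have : S = -S := by
      rw [hS, ← Finset.sum_neg_distrib,
        ← Fintype.sum_equiv (Equiv.mulLeft (Pi.mulSingle (π fun v => σ v.1) (-1 : ℤˣ))) _ _
          fun _ => rfl]
      refine Finset.sum_congr rfl fun ε _ => ?_
      simp [Pi.mulSingle_eq_of_ne hne'.symm]
    exact self_eq_neg.1 this
  · simp only [localize, entry_smul, entry_sum, entry_signedPerm_conj]
    congr 1
    -- Reindex the permutations by a transposition taking one outer configuration to the other.
    have hoff : (fun v : {u : Λ // u ∉ A} => σ v) =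
        (fun v : {u : Λ // u ∉ A} => τ v) := funext fun v => c v v.2
    have hoff' : (fun v : {u : Λ // u ∉ A} => σ' v) =
        (fun v : {u : Λ // u ∉ A} => τ' v) := funext fun v => d v v.2
    rw [Fintype.sum_prod_type_right, Fintype.sum_prod_type_right,
      ← Equiv.sum_comp (Equiv.mulRight (Equiv.swap
        (fun v : {u : Λ // u ∉ A} => σ v) (fun v => σ' v)))]
    refine Finset.sum_congr rfl fun π _ => Finset.sum_congr rfl fun ε _ => ?_
    have key : ∀ ρ ρ' : ∀ u : Λ, Fin (q u), (∀ u ∈ A, ρ u = ρ' u) →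
        (fun v : {u : Λ // u ∉ A} => ρ v.1) =
          (fun v : {u : Λ // u ∉ A} => σ v.1) →
        (fun v : {u : Λ // u ∉ A} => ρ' v.1) =
          (fun v : {u : Λ // u ∉ A} => σ' v.1) →
        actOff (Equiv.mulRight (Equiv.swap (fun v : {u : Λ // u ∉ A} => σ v.1) fun v => σ' v.1) π) ρ
          = actOff π ρ' := by
      intro ρ ρ' h h1 h2
      rw [actOff_eq_iff]
      obtain ⟨e1, e2⟩ := (actOff_eq_iff
        (Equiv.mulRight (Equiv.swap (fun v : {u : Λ // u ∉ A} => σ v.1) fun v => σ' v.1) π) ρ _).1 rfl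
      refine ⟨fun u hu => by rw [← e1 u hu, h u hu], ?_⟩
      rw [e2, h1, h2]
      simp
    rw [key σ σ' a rfl rfl, key τ τ' b hoff.symm hoff'.symm, ← hoff, ← hoff']
    simp

theorem norm_signedPerm_le (A : Finset Λ)
    (g : (OffConfig q A → ℤˣ) × Equiv.Perm (OffConfig q A)) : ‖signedPerm A g‖ ≤ 1 := by
  have h : ‖signedPerm A g‖ * ‖signedPerm A g‖ ≤ 1 := by
    rw [← CStarRing.norm_self_mul_star, signedPerm_mul_star]
    exact ContinuousLinearMap.norm_id_le
  nlinarith [norm_nonneg (signedPerm A g)]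

theorem norm_localize_le (A : Finset Λ) (O : Op q) : ‖localize A O‖ ≤ ‖O‖ := by
  rw [localize, norm_smul, norm_inv, Complex.norm_natCast, inv_mul_le_iff₀ (by
    exact_mod_cast Fintype.card_pos)]
  refine (norm_sum_le_of_le _ (fun g _ => ?_)).trans_eq
    (by rw [Finset.sum_const, Finset.card_univ, nsmul_eq_mul])
  refine (norm_mul_le _ _).trans ?_
  have := (norm_star (signedPerm A g)).trans_le (norm_signedPerm_le A g)
  refine (mul_le_of_le_one_right (norm_nonneg _) this).trans ?_
  exact (norm_mul_le _ _).trans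
    (mul_le_of_le_one_left (norm_nonneg _) (norm_signedPerm_le A g))

/-- An operator that almost commutes with the operators supported outside `A` is close to its
localization to `A`. -/
theorem norm_localize_sub_self_le {A : Finset Λ} {O : Op q} {δ : ℝ}
    (h : ∀ P : Op q, SupportedOn Aᶜ P → ‖P‖ ≤ 1 → ‖⁅O, P⁆‖ ≤ δ) :
    ‖localize A O - O‖ ≤ δ := by
  have hc : (0 : ℝ) <
      Fintype.card ((OffConfig q A → ℤˣ) × Equiv.Perm (OffConfig q A)) := by
    exact_mod_cast Fintype.card_pos
  have hO : O = (Fintype.card ((OffConfig q A → ℤˣ) × Equiv.Perm (OffConfig q A)) : ℂ)⁻¹ •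
      ∑ g : (OffConfig q A → ℤˣ) × Equiv.Perm (OffConfig q A), O := by
    rw [Finset.sum_const, Finset.card_univ, ← Nat.cast_smul_eq_nsmul ℂ, smul_smul,
      inv_mul_cancel₀ (by exact_mod_cast hc.ne'), one_smul]
  have hsub : localize A O - O =
      (Fintype.card ((OffConfig q A → ℤˣ) × Equiv.Perm (OffConfig q A)) : ℂ)⁻¹ •
        (∑ g : (OffConfig q A → ℤˣ) × Equiv.Perm (OffConfig q A),
          signedPerm A g * O * star (signedPerm A g) -
        ∑ g : (OffConfig q A → ℤˣ) × Equiv.Perm (OffConfig q A), O) := by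
    rw [smul_sub, ← hO, localize]
  rw [hsub, ← Finset.sum_sub_distrib, norm_smul, norm_inv,
    Complex.norm_natCast, inv_mul_le_iff₀ hc]
  refine (norm_sum_le_of_le _ (fun g _ => ?_)).trans_eq
    (by rw [Finset.sum_const, Finset.card_univ, nsmul_eq_mul])
  have e : signedPerm A g * O * star (signedPerm A g) - O =
      -⁅O, signedPerm A g⁆ * star (signedPerm A g) := by
    rw [Ring.lie_def, neg_sub, sub_mul, mul_assoc O, signedPerm_mul_star, mul_one]
  rw [e]
  refine (norm_mul_le _ _).trans ?_
  rw [norm_neg]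
  have hg := norm_signedPerm_le A g
  exact (mul_le_of_le_one_right (norm_nonneg _) ((norm_star (signedPerm A g)).trans_le hg)).trans
    (h _ (supportedOn_signedPerm A g) hg)

theorem localize_univ (O : Op q) : localize Finset.univ O = O := by
  refine sub_eq_zero.1 (norm_le_zero_iff.1 (norm_localize_sub_self_le fun P hP _ => ?_))
  rw [(supportedOn_univ O).lie_eq_zero hP disjoint_compl_right, norm_zero]

theorem continuous_localize (A : Finset Λ) : Continuous (localize A : Op q → Op q) := by
  unfold localize
  fun_prop

theorem isSelfAdjoint_localize (A : Finset Λ) {O : Op q} (hO : IsSelfAdjoint O) :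
    IsSelfAdjoint (localize A O) := by
  unfold localize
  refine IsSelfAdjoint.smul (by simp [IsSelfAdjoint]) ?_
  exact isSelfAdjoint_sum (R := Op q) _ fun g _ => hO.conjugate (signedPerm A g)

end Support

/-! ### Ordered exponentials -/

section Dyson

/-- Termwise differentiation of a series each of whose terms has as derivative a linear expression
`L r` in the previous term. -/
theorem hasDerivAt_tsum_of_succ {E : Type*} [NormedAddCommGroup E] [NormedSpace ℝ E]
    [CompleteSpace E] {f : ℕ → ℝ → E} {L : ℝ → E → E} {a : ℕ → ℝ} {M R s : ℝ}
    (ha : Summable a) (h0 : ∀ r, HasDerivAt (f 0) 0 r)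
    (hf : ∀ n r, HasDerivAt (f (n + 1)) (L r (f n r)) r)
    (hfa : ∀ n r, |r| ≤ R → ‖f n r‖ ≤ a n)
    (hL : ∀ r x, |r| ≤ R → ‖L r x‖ ≤ M * ‖x‖) (hM : 0 ≤ M)
    (hLs : ∀ x, HasSum (fun n => f n s) x → HasSum (fun n => L s (f n s)) (L s x))
    (hs : |s| < R) :
    HasDerivAt (fun r => ∑' n, f n r) (L s (∑' n, f n s)) s := by
  set d : ℕ → ℝ → E := fun n r => Nat.casesOn n 0 fun m => L r (f m r) with hd
  set u : ℕ → ℝ := fun n => Nat.casesOn n 0 fun m => M * a m with hu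
  have hus : Summable u := (summable_nat_add_iff 1).1 (ha.mul_left M)
  have hs' : s ∈ Set.Ioo (-R) R := abs_lt.1 hs
  have hsum : Summable fun n => f n s := Summable.of_norm_bounded ha fun n => hfa n s hs.le
  have key := hasDerivAt_tsum_of_isPreconnected (g := f) (g' := d) hus
    (isOpen_Ioo : IsOpen (Set.Ioo (-R) R)) isPreconnected_Ioo (fun n r _ => ?_) (fun n r hr => ?_)
    hs' hsum hs'
  · have e : ∑' n, d n s = L s (∑' n, f n s) := by
      have h1 := hLs _ hsum.hasSum
      have h2 : Summable fun n => d n s := (summable_nat_add_iff 1).1 h1.summable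
      rw [h2.tsum_eq_zero_add, ← h1.tsum_eq]
      exact zero_add _
    rwa [e] at key
  · cases n with
    | zero => exact h0 r
    | succ n => exact hf n r
  · have hr' : |r| ≤ R := (abs_lt.2 hr).le
    cases n with
    | zero => simp [hd, hu]
    | succ n => exact (hL r _ hr').trans (mul_le_mul_of_nonneg_left (hfa n r hr') hM)

theorem star_I_smul_mul_add {A : Type*} [Ring A] [Algebra ℂ A] [StarRing A] [StarModule ℂ A]
    {D : A} (hD : star D = D) (U : A) :
    star (Complex.I • (D * U)) * U + star U * Complex.I • (D * U) = 0 := by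
  simp [hD, mul_assoc]

variable {Λ : Type*} [Fintype Λ] [DecidableEq Λ] {q : Λ → ℕ}

theorem hasDerivAt_dysonTerm_succ {D : ℝ → Op q} (hD : Continuous D) {n : ℕ}
    (hn : Continuous (dysonTerm D n)) (s : ℝ) :
    HasDerivAt (dysonTerm D (n + 1)) (Complex.I • (D s * dysonTerm D n s)) s := by
  have hc : Continuous fun r => Complex.I • (D r * dysonTerm D n r) :=
    (hD.mul hn).const_smul Complex.I
  exact (hc.integral_hasStrictDerivAt 0 s).hasDerivAt

theorem continuous_dysonTerm {D : ℝ → Op q} (hD : Continuous D) (n : ℕ) :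
    Continuous (dysonTerm D n) := by
  induction n with
  | zero => exact continuous_const
  | succ n ih =>
    exact continuous_iff_continuousAt.2 fun s => (hasDerivAt_dysonTerm_succ hD ih s).continuousAt

theorem norm_dysonTerm_le {D : ℝ → Op q} {M R : ℝ} (hM : ∀ s, |s| ≤ R → ‖D s‖ ≤ M)
    (hD : Continuous D) (n : ℕ) {s : ℝ} (hs : |s| ≤ R) :
    ‖dysonTerm D n s‖ ≤ (M * |s|) ^ n / n.factorial := by
  have hM0 : 0 ≤ M := (norm_nonneg _).trans (hM s hs)
  induction n generalizing s with
  | zero =>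
    rw [pow_zero, Nat.factorial_zero, Nat.cast_one, div_one]
    exact ContinuousLinearMap.norm_id_le
  | succ n ih =>
    have hc := (hD.mul (continuous_dysonTerm hD n)).const_smul Complex.I
    calc ‖dysonTerm D (n + 1) s‖
        ≤ ∫ r in Set.uIoc 0 s, ‖Complex.I • (D r * dysonTerm D n r)‖ :=
          intervalIntegral.norm_integral_le_integral_norm_uIoc
      _ ≤ ∫ r in Set.uIoc 0 s, M * (M ^ n / n.factorial) * |r - 0| ^ n := by
          refine setIntegral_mono_on ?_ ?_ measurableSet_uIoc fun r hr => ?_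
          · exact (hc.norm.integrableOn_uIcc).mono_set Set.uIoc_subset_uIcc
          · refine (Continuous.integrableOn_uIcc ?_).mono_set Set.uIoc_subset_uIcc
            fun_prop
          · have hr' : |r| ≤ |s| := by
              have := Set.abs_sub_left_of_mem_uIcc (Set.uIoc_subset_uIcc hr)
              simpa using this
            have h1 : ‖Complex.I • (D r * dysonTerm D n r)‖ = ‖D r * dysonTerm D n r‖ := by
              rw [norm_smul, Complex.norm_I, one_mul]
            rw [h1, sub_zero]
            refine (norm_mul_le _ _).trans ?_
            rw [mul_assoc]
            refine mul_le_mul (hM r (hr'.trans hs)) ?_ (norm_nonneg _) hM0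
            exact (ih (hr'.trans hs)).trans_eq (by ring)
      _ = (M * |s|) ^ (n + 1) / (n + 1).factorial := by
          rw [integral_const_mul, integral_pow_abs_sub_uIoc, Nat.factorial_succ]
          push_cast
          rw [sub_zero]
          field_simp
          ring

/-- The ordered exponential solves the defining equation `∂ₛ U = i Dₛ U`. -/
theorem hasDerivAt_orderedExp {D : ℝ → Op q} (hD : Continuous D) (s : ℝ) :
    HasDerivAt (orderedExp D) (Complex.I • (D s * orderedExp D s)) s := by
  obtain ⟨M, hM⟩ : ∃ M, ∀ r ∈ Set.Icc (-(|s| + 1)) (|s| + 1), ‖D r‖ ≤ M :=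
    isCompact_Icc.exists_bound_of_continuousOn hD.continuousOn
  have hM' : ∀ r, |r| ≤ |s| + 1 → ‖D r‖ ≤ M := fun r hr => hM r (abs_le.1 hr)
  have hM0 : 0 ≤ M := (norm_nonneg _).trans (hM' s (by linarith))
  have hbd : ∀ n r, |r| ≤ |s| + 1 → ‖dysonTerm D n r‖ ≤ (M * (|s| + 1)) ^ n / n.factorial :=
    fun n r hr => (norm_dysonTerm_le hM' hD n hr).trans (by gcongr)
  refine hasDerivAt_tsum_of_succ (L := fun r x => Complex.I • (D r * x)) (M := M)
    (Real.summable_pow_div_factorial (M * (|s| + 1))) (fun r => hasDerivAt_const r (1 : Op q))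
    (fun n r => hasDerivAt_dysonTerm_succ hD (continuous_dysonTerm hD n) r) hbd
    (fun r x hr => ?_) hM0 (fun x hx => ?_) (lt_add_one _)
  · rw [norm_smul, Complex.norm_I, one_mul]
    exact (norm_mul_le _ _).trans (mul_le_mul_of_nonneg_right (hM' r hr) (norm_nonneg _))
  · exact (hx.mul_left (D s)).const_smul Complex.I

theorem orderedExp_zero (D : ℝ → Op q) : orderedExp D 0 = 1 := by
  rw [orderedExp, tsum_eq_single 0]
  · rfl
  · intro n hn
    obtain ⟨m, rfl⟩ := Nat.exists_eq_succ_of_ne_zero hn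
    exact intervalIntegral.integral_same

theorem mul_star_eq_one_of_star_mul {U : Op q} (h : star U * U = 1) : U * star U = 1 := by
  have h' : (star U).toLinearMap * U.toLinearMap = 1 := by
    rw [← ContinuousLinearMap.toLinearMap_mul, h]; rfl
  have h'' := mul_eq_one_comm.1 h'
  ext1 x
  exact LinearMap.congr_fun h'' x

theorem hasDerivAt_star {U : ℝ → Op q} {U' : Op q} {s : ℝ} (h : HasDerivAt U U' s) :
    HasDerivAt (fun r => star (U r)) (star U') s :=
  h.star

/-- Solutions of `∂ₛ U = i Dₛ U` with self-adjoint `Dₛ` and `U₀ = 1` are unitary. -/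
theorem mem_unitary_of_hasDerivAt {D U : ℝ → Op q} (hD : ∀ s, IsSelfAdjoint (D s))
    (hU : ∀ s, HasDerivAt U (Complex.I • (D s * U s)) s) (hU0 : U 0 = 1) (s : ℝ) :
    U s ∈ unitary (Op q) := by
  have hder : ∀ r, HasDerivAt (fun r => star (U r) * U r) 0 r := fun r => by
    have h := (hasDerivAt_star (hU r)).mul (hU r)
    rwa [star_I_smul_mul_add (hD r).star_eq (U r)] at h
  have hconst := is_const_of_deriv_eq_zero (fun r => (hder r).differentiableAt)
    (fun r => (hder r).deriv) s 0
  have h1 : star (U s) * U s = 1 := by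
    have h0 : star (U 0) * U 0 = 1 := by rw [hU0, star_one, one_mul]
    exact hconst.trans h0
  exact Unitary.mem_iff.2 ⟨h1, mul_star_eq_one_of_star_mul h1⟩

theorem orderedExp_mem_unitary {D : ℝ → Op q} (hD : Continuous D)
    (hsa : ∀ s, IsSelfAdjoint (D s)) (s : ℝ) : orderedExp D s ∈ unitary (Op q) :=
  mem_unitary_of_hasDerivAt hsa (hasDerivAt_orderedExp hD) (orderedExp_zero D) s

end Dyson

/-! ### The Lieb-Robinson bound -/

section LiebRobinson

section Algebra

variable {A : Type*} [Ring A] [Algebra ℂ A] [StarRing A] [StarModule ℂ A]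

theorem star_I_smul_mul_conj_add {D : A} (hD : star D = D) (W f R : A) :
    (star (Complex.I • (D * W)) * f + star W * (Complex.I • (D * f - f * D) + R)) * W +
      star W * f * Complex.I • (D * W) = star W * R * W := by
  simp only [star_smul, star_mul, hD, smul_mul_assoc, mul_smul_comm, mul_add, add_mul, mul_sub,
    sub_mul, mul_assoc, smul_sub, Complex.star_def, Complex.conj_I, neg_smul, neg_mul]
  abel

theorem star_I_smul_mul_lie_add {D E O U : A} (hD : star D = D) (hU : U * star U = 1)
    (hE : D * O - O * D = E * O - O * E) (P : A) :
    ((star (Complex.I • (D * U)) * O) * U + star U * O * Complex.I • (D * U)) * P -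
        P * ((star (Complex.I • (D * U)) * O) * U + star U * O * Complex.I • (D * U)) =
      Complex.I • (-(star U * E * U) * ⁅star U * O * U, P⁆ -
          ⁅star U * O * U, P⁆ * -(star U * E * U)) +
        Complex.I • ⁅star U * O * U, ⁅star U * E * U, P⁆⁆ := by
  have h1 : (star (Complex.I • (D * U)) * O) * U + star U * O * Complex.I • (D * U) =
      -(Complex.I • (star U * (D * O - O * D) * U)) := by
    simp only [star_smul, star_mul, hD, smul_mul_assoc, mul_smul_comm, mul_sub,
      sub_mul, mul_assoc, smul_sub, Complex.star_def, Complex.conj_I, neg_smul, neg_mul]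
    abel
  have h2 : star U * (E * O - O * E) * U =
      (star U * E * U) * (star U * O * U) - (star U * O * U) * (star U * E * U) := by
    have e : ∀ X Y : A, (star U * X * U) * (star U * Y * U) = star U * (X * Y) * U := fun X Y => by
      calc (star U * X * U) * (star U * Y * U) = star U * X * (U * star U) * Y * U := by noncomm_ring
        _ = star U * (X * Y) * U := by rw [hU]; noncomm_ring
    rw [e, e]
    noncomm_ring
  rw [h1, hE, h2]
  simp only [Ring.lie_def, smul_mul_assoc, mul_smul_comm, neg_mul, mul_neg, ← smul_neg, ← smul_add,
    ← smul_sub]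
  congr 1
  noncomm_ring

end Algebra

variable {Λ : Type*} [Fintype Λ] [DecidableEq Λ] {q : Λ → ℕ}

theorem norm_star_mul_mul {U : Op q} (hU : U ∈ unitary (Op q)) (X : Op q) :
    ‖star U * X * U‖ = ‖X‖ := by
  rw [CStarRing.norm_mul_mem_unitary _ hU, CStarRing.norm_mem_unitary_mul _ (Unitary.star_mem hU)]

theorem norm_mul_mul_star {U : Op q} (hU : U ∈ unitary (Op q)) (X : Op q) :
    ‖U * X * star U‖ = ‖X‖ := by
  rw [CStarRing.norm_mul_mem_unitary _ (Unitary.star_mem hU), CStarRing.norm_mem_unitary_mul _ hU]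

theorem norm_lie_le_two_mul (X Y : Op q) : ‖⁅X, Y⁆‖ ≤ 2 * ‖X‖ * ‖Y‖ := by
  rw [Ring.lie_def]
  refine (norm_sub_le _ _).trans ?_
  linarith [norm_mul_le X Y, norm_mul_le Y X, mul_comm ‖X‖ ‖Y‖]

/-- The self-adjoint commutator part of a differential equation does not contribute to the growth
of the norm: it is removed by conjugation with the unitaries it generates. -/
theorem norm_le_of_hasDerivAt_lie_add {f E R : ℝ → Op q} {b b' : ℝ → ℝ} {T : ℝ}
    (hE : Continuous E) (hEsa : ∀ s, IsSelfAdjoint (E s))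
    (hf : ∀ s, HasDerivAt f (Complex.I • (E s * f s - f s * E s) + R s) s)
    (hR : ∀ s ∈ Set.Ico 0 T, ‖R s‖ ≤ b' s) (hb : ∀ s, HasDerivAt b (b' s) s)
    (h0 : ‖f 0‖ ≤ b 0) {s : ℝ} (hs : s ∈ Set.Icc 0 T) : ‖f s‖ ≤ b s := by
  have hW := hasDerivAt_orderedExp hE
  have hWu := orderedExp_mem_unitary hE hEsa
  set W := orderedExp E
  have hg : ∀ r, HasDerivAt (fun r => star (W r) * f r * W r) (star (W r) * R r * W r) r := by
    intro r
    have h := ((hasDerivAt_star (hW r)).mul (hf r)).mul (hW r)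
    rwa [← star_I_smul_mul_conj_add (hEsa r).star_eq (W r) (f r) (R r)]
  have key := image_norm_le_of_norm_deriv_right_le_deriv_boundary (a := 0) (b := T)
    (f := fun r => star (W r) * f r * W r) (f' := fun r => star (W r) * R r * W r) (B := b)
    (B' := b') (fun r _ => (hg r).continuousAt.continuousWithinAt)
    (fun r _ => (hg r).hasDerivWithinAt)
    (by simpa only [norm_star_mul_mul (hWu 0)] using h0) hb
    (fun r hr => by simpa only [norm_star_mul_mul (hWu r)] using hR r hr) hs
  simpa only [norm_star_mul_mul (hWu s)] using key

/-- A Lieb-Robinson bound that holds for all regions improves: the differential inequality for the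
commutator is integrated once, and the weight reproduces itself under the sum over the terms that
meet the region. -/
theorem lieb_robinson_step {ι : Type*} [Fintype ι] {supp : ι → Finset Λ} {Φ : ℝ → ι → Op q}
    (hcont : ∀ i, Continuous fun s => Φ s i) (hsa : ∀ s i, IsSelfAdjoint (Φ s i))
    (hsupp : ∀ s i, SupportedOn (supp i) (Φ s i)) {U : ℝ → Op q}
    (hU : ∀ s, HasDerivAt U (Complex.I • ((∑ i, Φ s i) * U s)) s) (hU0 : U 0 = 1)
    {B : Finset Λ} {P : Op q} (hP : SupportedOn B P) {G : Finset Λ → ℝ} (hG0 : ∀ A, 0 ≤ G A)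
    (hG1 : ∀ A, ¬Disjoint A B → 1 ≤ G A) {c T : ℝ} (hc : 0 ≤ c)
    (hG : ∀ s ∈ Set.Icc 0 T, ∀ A, ∑ i with ¬Disjoint (supp i) A, ‖Φ s i‖ * G (supp i) ≤ c * G A)
    {S : ℝ} (hS : 0 ≤ S)
    (ih : ∀ A O, SupportedOn A O → ∀ s ∈ Set.Icc 0 T,
      ‖⁅star (U s) * O * U s, P⁆‖ ≤ S * (2 * Real.exp (4 * c * s) * G A * ‖O‖ * ‖P‖))
    {A : Finset Λ} {O : Op q} (hO : SupportedOn A O) {s : ℝ} (hs : s ∈ Set.Icc 0 T) :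
    ‖⁅star (U s) * O * U s, P⁆‖ ≤
      (1 + S / 2) * (2 * Real.exp (4 * c * s) * G A * ‖O‖ * ‖P‖) := by
  have hDsa : ∀ s, IsSelfAdjoint (∑ i, Φ s i) := fun s =>
    isSelfAdjoint_sum (R := Op q) _ fun i _ => hsa s i
  have hUu := mem_unitary_of_hasDerivAt hDsa hU hU0
  have hUcont : Continuous U := continuous_iff_continuousAt.2 fun s => (hU s).continuousAt
  have hUcont' : Continuous fun s => star (U s) :=
    continuous_iff_continuousAt.2 fun s => (hasDerivAt_star (hU s)).continuousAt
  -- Only the terms of the generator that meet `A` contribute to the evolution of `O`.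
  set DA : ℝ → Op q := fun s => ∑ i with ¬Disjoint (supp i) A, Φ s i with hDA
  have hDAsa : ∀ s, IsSelfAdjoint (DA s) := fun s =>
    isSelfAdjoint_sum (R := Op q) _ fun i _ => hsa s i
  have hDAcont : Continuous DA := continuous_finsetSum _ fun i _ => hcont i
  have hDO : ∀ s, (∑ i, Φ s i) * O - O * (∑ i, Φ s i) = DA s * O - O * DA s := by
    intro s
    rw [hDA]
    simp only [Finset.sum_mul, Finset.mul_sum, ← Finset.sum_sub_distrib]
    refine (Finset.sum_subset (Finset.filter_subset _ _) fun i _ hi => ?_).symm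
    rw [(hsupp s i).mul_comm hO (by simpa using hi), sub_self]
  set E : ℝ → Op q := fun s => -(star (U s) * DA s * U s) with hE
  set R : ℝ → Op q := fun s =>
    Complex.I • ⁅star (U s) * O * U s, ⁅star (U s) * DA s * U s, P⁆⁆ with hR
  have hf : ∀ s, HasDerivAt (fun s => ⁅star (U s) * O * U s, P⁆)
      (Complex.I • (E s * ⁅star (U s) * O * U s, P⁆ - ⁅star (U s) * O * U s, P⁆ * E s) + R s) s := by
    intro s
    have h := ((hasDerivAt_star (hU s)).mul_const O).mul (hU s)
    have h' := (h.mul_const P).sub (h.const_mul P)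
    rw [hE, hR]
    rw [← star_I_smul_mul_lie_add (hDsa s).star_eq (Unitary.mul_star_self_of_mem (hUu s)) (hDO s) P]
    exact h'
  have hRb : ∀ s ∈ Set.Ico 0 T, ‖R s‖ ≤
      2 * (S / 2 * (Real.exp (4 * c * s) * (4 * c))) * G A * ‖O‖ * ‖P‖ := by
    intro s hs
    have hs' : s ∈ Set.Icc 0 T := Set.Ico_subset_Icc_self hs
    have h1 : ‖⁅star (U s) * DA s * U s, P⁆‖ ≤
        S * (2 * Real.exp (4 * c * s) * ‖P‖) * (c * G A) := by
      have e : ⁅star (U s) * DA s * U s, P⁆ =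
          ∑ i with ¬Disjoint (supp i) A, ⁅star (U s) * Φ s i * U s, P⁆ := by
        simp only [hDA, Ring.lie_def, Finset.sum_mul, Finset.mul_sum, ← Finset.sum_sub_distrib]
      rw [e]
      calc _ ≤ ∑ i with ¬Disjoint (supp i) A,
              S * (2 * Real.exp (4 * c * s) * G (supp i) * ‖Φ s i‖ * ‖P‖) :=
            norm_sum_le_of_le _ fun i _ => ih _ _ (hsupp s i) s hs'
        _ = S * (2 * Real.exp (4 * c * s) * ‖P‖) *
              ∑ i with ¬Disjoint (supp i) A, ‖Φ s i‖ * G (supp i) := by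
            rw [Finset.mul_sum]
            exact Finset.sum_congr rfl fun i _ => by ring
        _ ≤ _ := mul_le_mul_of_nonneg_left (hG s hs' A) (by positivity)
    have h2 : ‖R s‖ = ‖⁅star (U s) * O * U s, ⁅star (U s) * DA s * U s, P⁆⁆‖ := by
      rw [hR, norm_smul, Complex.norm_I, one_mul]
    rw [h2]
    refine (norm_lie_le_two_mul _ _).trans ?_
    rw [norm_star_mul_mul (hUu s)]
    refine (mul_le_mul_of_nonneg_left h1 (by positivity)).trans_eq ?_
    ring
  have hb : ∀ s, HasDerivAt
      (fun s => 2 * (1 + S / 2 * Real.exp (4 * c * s)) * G A * ‖O‖ * ‖P‖)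
      (2 * (S / 2 * (Real.exp (4 * c * s) * (4 * c))) * G A * ‖O‖ * ‖P‖) s := by
    intro s
    have h1 : HasDerivAt (fun s : ℝ => 4 * c * s) (4 * c) s := by
      simpa using (hasDerivAt_id s).const_mul (4 * c)
    exact (((((h1.exp.const_mul (S / 2)).const_add 1).const_mul 2).mul_const (G A)).mul_const
      ‖O‖).mul_const ‖P‖
  have hOP : 0 ≤ G A * ‖O‖ * ‖P‖ := by have := hG0 A; positivity
  have h0 : ‖⁅star (U 0) * O * U 0, P⁆‖ ≤
      2 * (1 + S / 2 * Real.exp (4 * c * 0)) * G A * ‖O‖ * ‖P‖ := by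
    rw [hU0, star_one, one_mul, mul_one, mul_zero, Real.exp_zero, mul_one]
    by_cases hAB : Disjoint A B
    · rw [hO.lie_eq_zero hP hAB, norm_zero]
      have := hG0 A
      positivity
    · refine (norm_lie_le_two_mul _ _).trans ?_
      have h1 := mul_le_mul_of_nonneg_right (hG1 A hAB) (by positivity : 0 ≤ ‖O‖ * ‖P‖)
      nlinarith
  have key := norm_le_of_hasDerivAt_lie_add (E := E) (R := R) (T := T)
    ((hUcont'.mul hDAcont).mul hUcont).neg
    (fun s => IsSelfAdjoint.neg (R := Op q) ((hDAsa s).conjugate' (U s))) hf hRb hb h0 hs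
  refine key.trans ?_
  have h1 : 1 ≤ Real.exp (4 * c * s) := Real.one_le_exp (by have := hs.1; positivity)
  nlinarith [mul_le_mul_of_nonneg_right h1 hOP]

/-- **Lieb-Robinson bound** for the evolution generated by a time-dependent interaction, with an
abstract weight `G` measuring the influence of a region on the region `B`. The weight has to be at
least one on regions that meet `B`, and to be reproduced by the interaction up to a constant. -/
theorem lieb_robinson {ι : Type*} [Fintype ι] {supp : ι → Finset Λ} {Φ : ℝ → ι → Op q}
    (hcont : ∀ i, Continuous fun s => Φ s i) (hsa : ∀ s i, IsSelfAdjoint (Φ s i))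
    (hsupp : ∀ s i, SupportedOn (supp i) (Φ s i)) {U : ℝ → Op q}
    (hU : ∀ s, HasDerivAt U (Complex.I • ((∑ i, Φ s i) * U s)) s) (hU0 : U 0 = 1)
    {B : Finset Λ} {P : Op q} (hP : SupportedOn B P) {G : Finset Λ → ℝ} (hG0 : ∀ A, 0 ≤ G A)
    (hGpos : ∀ A : Finset Λ, A.Nonempty → 0 < G A)
    (hG1 : ∀ A, ¬Disjoint A B → 1 ≤ G A) {c T : ℝ} (hc : 0 ≤ c)
    (hG : ∀ s ∈ Set.Icc 0 T, ∀ A, ∑ i with ¬Disjoint (supp i) A, ‖Φ s i‖ * G (supp i) ≤ c * G A)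
    {A : Finset Λ} {O : Op q} (hO : SupportedOn A O) {s : ℝ} (hs : s ∈ Set.Icc 0 T) :
    ‖⁅star (U s) * O * U s, P⁆‖ ≤ 4 * Real.exp (4 * c * s) * G A * ‖O‖ * ‖P‖ := by
  have hUu := mem_unitary_of_hasDerivAt
    (fun s => isSelfAdjoint_sum (R := Op q) _ fun i _ => hsa s i) hU hU0
  -- A crude constant, depending on the system, to start the iteration from.
  set L : ℝ := ∑ A : Finset Λ, (G A)⁻¹ with hL
  have hL0 : 0 ≤ L := Finset.sum_nonneg fun A _ => inv_nonneg.2 (hG0 A)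
  have hLG : ∀ A : Finset Λ, A.Nonempty → 1 ≤ L * G A := fun A hA => by
    have h1 : (G A)⁻¹ ≤ L :=
      Finset.single_le_sum (f := fun A => (G A)⁻¹) (fun A _ => inv_nonneg.2 (hG0 A))
        (Finset.mem_univ A)
    calc (1 : ℝ) = (G A)⁻¹ * G A := (inv_mul_cancel₀ (hGpos A hA).ne').symm
      _ ≤ L * G A := mul_le_mul_of_nonneg_right h1 (hG0 A)
  have hiter : ∀ n : ℕ, ∀ A O, SupportedOn A O → ∀ s ∈ Set.Icc 0 T,
      ‖⁅star (U s) * O * U s, P⁆‖ ≤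
        (2 + L / 2 ^ n) * (2 * Real.exp (4 * c * s) * G A * ‖O‖ * ‖P‖) := by
    intro n
    induction n with
    | zero =>
      intro A O hO s hs
      have hpos : 0 ≤ (2 + L / 2 ^ 0) * (2 * Real.exp (4 * c * s) * G A * ‖O‖ * ‖P‖) := by
        have := hG0 A
        positivity
      rcases A.eq_empty_or_nonempty with rfl | hA
      · have h1 : O * U s = U s * O :=
          hO.mul_comm (supportedOn_univ (U s)) (Finset.disjoint_empty_left _)
        rw [mul_assoc, h1, ← mul_assoc, Unitary.star_mul_self_of_mem (hUu s), one_mul,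
          hO.lie_eq_zero hP (Finset.disjoint_empty_left _), norm_zero]
        exact hpos
      · refine (norm_lie_le_two_mul _ _).trans ?_
        rw [norm_star_mul_mul (hUu s)]
        have h1 : 1 ≤ Real.exp (4 * c * s) := Real.one_le_exp (by have := hs.1; positivity)
        have h2 : 1 ≤ (2 + L / 2 ^ 0) * (Real.exp (4 * c * s) * G A) := by
          have h3 : L * G A ≤ (2 + L / 2 ^ 0) * G A :=
            mul_le_mul_of_nonneg_right (by rw [pow_zero]; linarith) (hG0 A)
          have h4 := mul_le_mul h1 ((hLG A hA).trans h3) zero_le_one (by positivity)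
          linarith
        have h5 := mul_le_mul_of_nonneg_right h2 (by positivity : 0 ≤ 2 * ‖O‖ * ‖P‖)
        linarith
    | succ n ih =>
      intro A O hO s hs
      have h := lieb_robinson_step hcont hsa hsupp hU hU0 hP hG0 hG1 hc hG
        (by positivity : 0 ≤ 2 + L / 2 ^ n) ih hO hs
      refine h.trans_eq ?_
      rw [pow_succ]
      ring
  have hlim : Tendsto
      (fun n : ℕ => (2 + L / 2 ^ n) * (2 * Real.exp (4 * c * s) * G A * ‖O‖ * ‖P‖)) atTop
      (nhds ((2 + 0) * (2 * Real.exp (4 * c * s) * G A * ‖O‖ * ‖P‖))) := by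
    refine Tendsto.mul_const _ (Tendsto.const_add _ ?_)
    exact tendsto_const_nhds.div_atTop (tendsto_pow_atTop_atTop_of_one_lt one_lt_two)
  refine (ge_of_tendsto' hlim fun n => hiter n A O hO s hs).trans_eq ?_
  ring

end LiebRobinson

/-! ### Decay and phase of the filter function -/

section Filter

open FourierTransform SchwartzMap

/-- The Fourier transform is self-adjoint. -/
theorem integral_fourier_mul_eq_integral_mul_fourier {f g : ℝ → ℂ} (hf : Integrable f)
    (hg : Integrable g) : ∫ w, 𝓕 f w * g w = ∫ t, f t * 𝓕 g t := by
  have h := VectorFourier.integral_fourierIntegral_smul_eq_flip (L := innerₗ ℝ)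
    Real.continuous_fourierChar continuous_inner hf hg
  rw [flip_innerₗ] at h
  exact h

/-- Derivatives of a Fourier transform, tested against a Schwartz function. -/
theorem integral_mul_schwartz_of_hasDerivAt {F : ℝ → ℂ} (hF : Integrable F) {Q : ℕ → ℝ → ℂ}
    (hQ0 : Q 0 = 𝓕 F) (hQ : ∀ k w, HasDerivAt (Q k) (Q (k + 1) w) w)
    (hQb : ∀ k, ∃ C, ∀ w, ‖Q k w‖ ≤ C) (k : ℕ) (φ : 𝓢(ℝ, ℂ)) :
    ∫ w, Q k w * φ w = (-1) ^ k * ∫ t, F t * ((2 * Real.pi * Complex.I * t) ^ k * 𝓕 (φ : ℝ → ℂ) t) := by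
  have hint : ∀ k (ψ : 𝓢(ℝ, ℂ)), Integrable fun w => Q k w * ψ w := fun k ψ => by
    obtain ⟨C, hC⟩ := hQb k
    exact ψ.integrable.bdd_mul (c := C)
      (continuous_iff_continuousAt.2 fun w => (hQ k w).continuousAt).aestronglyMeasurable
      (Eventually.of_forall hC)
  induction k generalizing φ with
  | zero =>
    simp only [pow_zero, one_mul, hQ0]
    exact integral_fourier_mul_eq_integral_mul_fourier hF φ.integrable
  | succ k ih =>
    set φ' := SchwartzMap.derivCLM ℂ ℂ φ with hφ'
    have hderiv : ∀ x, HasDerivAt (φ : ℝ → ℂ) (φ' x) x := fun x => φ.differentiableAt.hasDerivAt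
    have h1 := integral_mul_deriv_eq_deriv_mul_of_integrable (u := Q k) (v := φ)
      (u' := Q (k + 1)) (v' := φ') (fun x _ => hQ k x) (fun x _ => hderiv x) (hint k φ')
      (hint (k + 1) φ) (hint k φ)
    have h2 : 𝓕 (φ' : ℝ → ℂ) = fun t : ℝ => (2 * Real.pi * Complex.I * t) • 𝓕 (φ : ℝ → ℂ) t := by
      have e : (φ' : ℝ → ℂ) = deriv φ := funext fun x => ((hderiv x).deriv).symm
      have := φ'.integrable (μ := volume)
      rw [e] at this ⊢
      exact Real.fourier_deriv φ.integrable φ.differentiable this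
    rw [eq_neg_iff_add_eq_zero, add_comm, ← eq_neg_iff_add_eq_zero] at h1
    rw [h1, ih φ', h2, pow_succ (-1 : ℂ), mul_neg_one, neg_mul]
    congr 2
    refine integral_congr_ae (Eventually.of_forall fun t => ?_)
    simp only [smul_eq_mul]
    ring

/-- If the derivatives of the Fourier transform of `F` are bounded and the `k`-th one is
integrable, then `t ^ k * F t` is, up to constants, the Fourier transform of that derivative. -/
theorem pow_mul_ae_eq_fourier {F : ℝ → ℂ} (hF : Integrable F) {Q : ℕ → ℝ → ℂ}
    (hQ0 : Q 0 = 𝓕 F) (hQ : ∀ k w, HasDerivAt (Q k) (Q (k + 1) w) w)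
    (hQb : ∀ k, ∃ C, ∀ w, ‖Q k w‖ ≤ C) {k : ℕ} (hk : Integrable (Q k)) :
    ∀ᵐ t : ℝ, F t * (2 * Real.pi * Complex.I * t) ^ k = (-1) ^ k * 𝓕 (Q k) (-t) := by
  have hcont : Continuous (𝓕 (Q k)) :=
    VectorFourier.fourierIntegral_continuous Real.continuous_fourierChar continuous_inner hk
  refine ae_eq_of_integral_contDiff_smul_eq ?_ ?_ fun g hg hgc => ?_
  · exact hF.locallyIntegrable.mul_continuous (by fun_prop)
  · exact (continuous_const.mul (hcont.comp continuous_neg)).locallyIntegrable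
  have hg₁ : HasCompactSupport (Complex.ofRealCLM ∘ g) := hgc.comp_left rfl
  have hg₂ : ContDiff ℝ (⊤ : ℕ∞) (Complex.ofRealCLM ∘ g) := by fun_prop
  set ψ : 𝓢(ℝ, ℂ) := hg₁.toSchwartzMap hg₂ with hψ
  have hψg : ∀ t, ψ t = g t := fun t => rfl
  set φ : 𝓢(ℝ, ℂ) := 𝓕⁻ ψ with hφ
  have hφψ : 𝓕 (φ : ℝ → ℂ) = ψ := by
    rw [← SchwartzMap.fourier_coe, hφ, FourierTransform.fourier_fourierInv_eq]
  have hφ' : (φ : ℝ → ℂ) = 𝓕 (fun t => ψ (-t)) := by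
    rw [hφ, SchwartzMap.fourierInv_coe, Real.fourierInv_eq_fourier_comp_neg]
  have hψn : Integrable fun t => ψ (-t) := ψ.integrable.comp_neg
  have h1 := integral_mul_schwartz_of_hasDerivAt hF hQ0 hQ hQb k φ
  rw [hφψ, hφ', ← integral_fourier_mul_eq_integral_mul_fourier hk hψn] at h1
  have h2 : ∫ t, g t • (F t * (2 * Real.pi * Complex.I * t) ^ k) =
      ∫ t, F t * ((2 * Real.pi * Complex.I * t) ^ k * ψ t) :=
    integral_congr_ae (Eventually.of_forall fun t => by
      simp only [hψg, Complex.real_smul]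
      ring)
  have h3 : ∫ t, g t • ((-1) ^ k * 𝓕 (Q k) (-t)) = (-1) ^ k * ∫ t, 𝓕 (Q k) t * ψ (-t) := by
    rw [← integral_neg_eq_self, ← integral_const_mul]
    refine integral_congr_ae (Eventually.of_forall fun t => ?_)
    simp only [hψg, Complex.real_smul, neg_neg]
    ring
  rw [h2, h3, h1, ← mul_assoc, ← mul_pow]
  norm_num

theorem ae_eq_zero_of_fourier_eq_zero {F : ℝ → ℂ} (hF : Integrable F) (h : 𝓕 F = 0) :
    ∀ᵐ t : ℝ, F t = 0 := by
  have := pow_mul_ae_eq_fourier hF (Q := fun _ => 0) h.symm (fun k w => hasDerivAt_const w 0)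
    (fun k => ⟨0, fun w => by simp⟩) (k := 0) (integrable_zero _ _ _)
  filter_upwards [this] with t ht
  simpa [Real.fourier_eq] using ht

theorem fourier_filterFunction {F : ℝ → ℂ} {g : ℝ → ℝ}
    (hg : ∀ ω : ℝ, ∫ t : ℝ, F t * Complex.exp (Complex.I * (ω : ℂ) * (t : ℂ)) = (g ω : ℂ)) :
    𝓕 F = fun w => ((g (-2 * Real.pi * w) : ℝ) : ℂ) := by
  funext w
  rw [← hg, Real.fourier_real_eq_integral_exp_smul]
  refine integral_congr_ae (Eventually.of_forall fun t => ?_)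
  simp only [smul_eq_mul]
  rw [mul_comm]
  congr 2
  push_cast
  ring

/-- The derivatives of a smooth function that equals `-1/ω` for large `ω` decay like those of
`1/ω`. -/
theorem exists_iteratedDeriv_bound {g : ℝ → ℝ} (hg : ContDiff ℝ (⊤ : ℕ∞) g)
    (hg1 : ∀ ω : ℝ, 1 / 2 ≤ |ω| → g ω = -1 / ω) (k : ℕ) :
    ∃ C, ∀ w, |iteratedDeriv k (fun w => g (-2 * Real.pi * w)) w| ≤ C ∧
      (k ≠ 0 → |iteratedDeriv k (fun w => g (-2 * Real.pi * w)) w| ≤ C * (1 + w ^ 2)⁻¹) := by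
  set G : ℝ → ℝ := fun w => g (-2 * Real.pi * w) with hG
  have hGs : ContDiff ℝ (⊤ : ℕ∞) G := hg.comp (contDiff_const.mul contDiff_id)
  have hcont : Continuous (iteratedDeriv k G) := hGs.continuous_iteratedDeriv k (mod_cast le_top)
  obtain ⟨M, hM⟩ := (isCompact_Icc (a := (-1 : ℝ)) (b := 1)).exists_bound_of_continuousOn
    hcont.continuousOn
  have hM0 : 0 ≤ M := (norm_nonneg _).trans (hM 0 (by simp))
  have hfar : ∀ w : ℝ, 1 < |w| → |iteratedDeriv k G w| ≤ k.factorial * |w|⁻¹ ^ (k + 1) := by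
    intro w hw
    have hev : G =ᶠ[nhds w] fun w => (2 * Real.pi)⁻¹ * w⁻¹ := by
      filter_upwards [continuous_abs.continuousAt.eventually (lt_mem_nhds hw)] with v hv
      have hpi := Real.pi_gt_three
      have hv0 : v ≠ 0 := fun h => by simp [h] at hv; linarith
      rw [hG]
      simp only
      rw [hg1]
      · field_simp
      · rw [abs_mul, abs_mul, abs_neg, abs_of_pos Real.pi_pos, abs_two]
        nlinarith
    rw [hev.iteratedDeriv_eq, iteratedDeriv_const_mul_field, iteratedDeriv_eq_iterate]
    have := iter_deriv_inv k w
    rw [this, abs_mul, abs_mul, abs_mul, abs_pow, abs_neg, abs_one, one_pow, one_mul,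
      Nat.abs_cast, abs_zpow]
    have e2 : |w| ^ (-1 - k : ℤ) = |w|⁻¹ ^ (k + 1) := by
      rw [inv_pow, ← zpow_natCast, ← zpow_neg]
      congr 1
      push_cast
      ring
    rw [e2]
    refine mul_le_of_le_one_left (by positivity) ?_
    rw [abs_of_pos (by positivity)]
    exact inv_le_one_of_one_le₀ (by linarith [Real.pi_gt_three])
  have hnear : ∀ w : ℝ, |w| ≤ 1 → |iteratedDeriv k G w| ≤ M := fun w hw => hM w (abs_le.1 hw)
  refine ⟨2 * M + 2 * k.factorial, fun w => ⟨?_, fun hk => ?_⟩⟩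
  · rcases le_or_gt |w| 1 with hw | hw
    · exact (hnear w hw).trans (by
        have : (0 : ℝ) ≤ k.factorial := by positivity
        linarith)
    · refine (hfar w hw).trans ?_
      have h1 : |w|⁻¹ ^ (k + 1) ≤ 1 := pow_le_one₀ (by positivity) (inv_le_one_of_one_le₀ hw.le)
      have h2 : (0 : ℝ) ≤ k.factorial := by positivity
      nlinarith
  · rw [← div_eq_mul_inv, le_div_iff₀ (by positivity)]
    rcases le_or_gt |w| 1 with hw | hw
    · have h1 : w ^ 2 ≤ 1 := (sq_le_one_iff_abs_le_one w).2 hw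
      have h2 : (0 : ℝ) ≤ k.factorial := by positivity
      have h3 := hnear w hw
      have h4 := abs_nonneg (iteratedDeriv k G w)
      nlinarith
    · have h1 : |w|⁻¹ ^ (k + 1) ≤ |w|⁻¹ ^ 2 :=
        pow_le_pow_of_le_one (by positivity) (inv_le_one_of_one_le₀ hw.le) (by omega)
      have h2 : (0 : ℝ) ≤ k.factorial := by positivity
      have h3 : 1 + w ^ 2 ≤ 2 * |w| ^ 2 := by rw [← sq_abs w]; nlinarith
      calc |iteratedDeriv k G w| * (1 + w ^ 2)
          ≤ (k.factorial * |w|⁻¹ ^ 2) * (2 * |w| ^ 2) :=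
            mul_le_mul ((hfar w hw).trans (mul_le_mul_of_nonneg_left h1 h2)) h3 (by positivity)
              (by positivity)
        _ = 2 * k.factorial := by
            have : |w| ≠ 0 := by linarith
            field_simp
        _ ≤ _ := by linarith

/-- A filter function decays faster than any power: all its moments are finite. -/
theorem IsFilterFunction.integrable_pow {F : ℝ → ℂ} (hF : IsFilterFunction F) (n : ℕ) :
    Integrable fun t : ℝ => ‖F t‖ * (1 + |t|) ^ n := by
  obtain ⟨g, hg, hgF, hg1⟩ := hF.fourier
  set G : ℝ → ℝ := fun w => g (-2 * Real.pi * w) with hG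
  have hGs : ContDiff ℝ (⊤ : ℕ∞) G := hg.comp (contDiff_const.mul contDiff_id)
  set Q : ℕ → ℝ → ℂ := fun k w => ((iteratedDeriv k G w : ℝ) : ℂ) with hQdef
  have hQ0 : Q 0 = 𝓕 F := by
    rw [fourier_filterFunction hgF]
    funext w
    simp [hQdef, hG]
  have hQ : ∀ k w, HasDerivAt (Q k) (Q (k + 1) w) w := fun k w => by
    have h1 : HasDerivAt (iteratedDeriv k G) (iteratedDeriv (k + 1) G w) w := by
      rw [iteratedDeriv_succ]
      exact ((hGs.differentiable_iteratedDeriv k (by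
        exact_mod_cast WithTop.coe_lt_top _)) w).hasDerivAt
    exact h1.ofReal_comp
  have hQb : ∀ k, ∃ C, ∀ w, ‖Q k w‖ ≤ C := fun k => by
    obtain ⟨C, hC⟩ := exists_iteratedDeriv_bound hg hg1 k
    exact ⟨C, fun w => by
      exact (Complex.norm_real _).trans_le (hC w).1⟩
  have hQi : Integrable (Q (n + 2)) := by
    obtain ⟨C, hC⟩ := exists_iteratedDeriv_bound hg hg1 (n + 2)
    refine (integrable_inv_one_add_sq.const_mul C).mono'
      (continuous_iff_continuousAt.2 fun w => (hQ _ w).continuousAt).aestronglyMeasurable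
      (Eventually.of_forall fun w => ?_)
    exact (Complex.norm_real _).trans_le ((hC w).2 (by omega))
  have hae := pow_mul_ae_eq_fourier hF.integrable hQ0 hQ hQb hQi
  set C : ℝ := ∫ w, ‖Q (n + 2) w‖ with hCdef
  have hC0 : 0 ≤ C := integral_nonneg fun w => norm_nonneg _
  refine ((hF.integrable.norm.add (integrable_inv_one_add_sq.const_mul (2 * C))).const_mul
    (2 ^ n)).mono' (hF.integrable.aestronglyMeasurable.norm.mul
      (by fun_prop : Continuous fun t : ℝ => (1 + |t|) ^ n).aestronglyMeasurable) ?_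
  filter_upwards [hae] with t ht
  have hb : ‖F t‖ * |t| ^ (n + 2) ≤ C := by
    have h1 : ‖F t * (2 * Real.pi * Complex.I * t) ^ (n + 2)‖ ≤ C := by
      rw [ht, norm_mul, norm_pow, norm_neg, norm_one, one_pow, one_mul]
      exact VectorFourier.norm_fourierIntegral_le_integral_norm _ _ _ _ _
    have h2 : ‖F t * (2 * Real.pi * Complex.I * t) ^ (n + 2)‖ =
        ‖F t‖ * ((2 * Real.pi) ^ (n + 2) * |t| ^ (n + 2)) := by
      simp [mul_pow, abs_of_pos Real.pi_pos]
    rw [h2] at h1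
    refine le_trans ?_ h1
    refine mul_le_mul_of_nonneg_left ?_ (norm_nonneg _)
    exact le_mul_of_one_le_left (by positivity)
      (one_le_pow₀ (by linarith [Real.pi_gt_three]))
  rw [Real.norm_of_nonneg (by positivity)]
  simp only [Pi.add_apply]
  have hinv : 0 ≤ 2 * C * (1 + t ^ 2)⁻¹ := by positivity
  rcases le_or_gt |t| 1 with h | h
  · have h1 : (1 + |t|) ^ n ≤ 2 ^ n := pow_le_pow_left₀ (by positivity) (by linarith) n
    calc ‖F t‖ * (1 + |t|) ^ n ≤ ‖F t‖ * 2 ^ n := mul_le_mul_of_nonneg_left h1 (norm_nonneg _)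
      _ ≤ 2 ^ n * (‖F t‖ + 2 * C * (1 + t ^ 2)⁻¹) := by
        rw [mul_comm]
        exact mul_le_mul_of_nonneg_left (by linarith) (by positivity)
  · have h1 : (1 + |t|) ^ n ≤ (2 * |t|) ^ n := pow_le_pow_left₀ (by positivity) (by linarith) n
    have h2 : ‖F t‖ * |t| ^ n ≤ 2 * C * (1 + t ^ 2)⁻¹ := by
      rw [← div_eq_mul_inv, le_div_iff₀ (by positivity)]
      have h3 : 1 + t ^ 2 ≤ 2 * |t| ^ 2 := by rw [← sq_abs t]; nlinarith
      calc ‖F t‖ * |t| ^ n * (1 + t ^ 2) ≤ ‖F t‖ * |t| ^ n * (2 * |t| ^ 2) :=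
            mul_le_mul_of_nonneg_left h3 (by positivity)
        _ = 2 * (‖F t‖ * |t| ^ (n + 2)) := by ring
        _ ≤ 2 * C := by linarith
    calc ‖F t‖ * (1 + |t|) ^ n ≤ ‖F t‖ * (2 * |t|) ^ n :=
          mul_le_mul_of_nonneg_left h1 (norm_nonneg _)
      _ = 2 ^ n * (‖F t‖ * |t| ^ n) := by rw [mul_pow]; ring
      _ ≤ 2 ^ n * (‖F t‖ + 2 * C * (1 + t ^ 2)⁻¹) :=
        mul_le_mul_of_nonneg_left (by linarith [norm_nonneg (F t)]) (by positivity)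

/-- An odd function with real Fourier transform is purely imaginary. -/
theorem IsFilterFunction.ae_conj_eq_neg {F : ℝ → ℂ} (hF : IsFilterFunction F) :
    ∀ᵐ t : ℝ, star (F t) = -F t := by
  obtain ⟨g, -, hgF, -⟩ := hF.fourier
  have hodd : ∀ ω, g (-ω) = -g ω := fun ω => by
    have h1 : ∫ t : ℝ, F t * Complex.exp (Complex.I * ((-ω : ℝ) : ℂ) * (t : ℂ)) =
        -∫ t : ℝ, F t * Complex.exp (Complex.I * (ω : ℂ) * (t : ℂ)) := by
      rw [← integral_neg_eq_self, ← integral_neg]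
      refine integral_congr_ae (Eventually.of_forall fun t => ?_)
      simp only [hF.odd]
      push_cast
      ring_nf
    rw [hgF, hgF] at h1
    exact_mod_cast h1
  have hconj : Integrable fun t => star (F t) := 
    hF.integrable.norm.mono' (continuous_star.comp_aestronglyMeasurable
      hF.integrable.aestronglyMeasurable) (Eventually.of_forall fun t => (norm_star (F t)).le)
  have hfour : 𝓕 (fun t => star (F t) + F t) = 0 := by
    funext w
    set ω : ℝ := -2 * Real.pi * w with hω
    have h1 : ∫ t : ℝ, star (F t) * Complex.exp (Complex.I * (ω : ℂ) * (t : ℂ)) = (g (-ω) : ℂ) := by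
      rw [← Complex.conj_ofReal (g (-ω)), ← hgF, ← integral_conj]
      refine integral_congr_ae (Eventually.of_forall fun t => ?_)
      simp [← Complex.exp_conj]
    have hexp : ∀ f : ℝ → ℂ, Integrable f →
        Integrable fun t : ℝ => f t * Complex.exp (Complex.I * (ω : ℂ) * (t : ℂ)) := fun f hf => by
      refine hf.mul_bdd (c := 1) (by fun_prop) (Eventually.of_forall fun t => ?_)
      rw [show Complex.I * (ω : ℂ) * (t : ℂ) = ((ω * t : ℝ) : ℂ) * Complex.I by push_cast; ring,
        Complex.norm_exp_ofReal_mul_I]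
    rw [Real.fourier_real_eq_integral_exp_smul]
    have h2 : ∫ t : ℝ, Complex.exp (↑(-2 * Real.pi * t * w) * Complex.I) • (star (F t) + F t) =
        ∫ t : ℝ, (star (F t) * Complex.exp (Complex.I * (ω : ℂ) * (t : ℂ)) +
          F t * Complex.exp (Complex.I * (ω : ℂ) * (t : ℂ))) := by
      refine integral_congr_ae (Eventually.of_forall fun t => ?_)
      simp only [smul_eq_mul]
      rw [← add_mul, mul_comm, hω]
      congr 2
      push_cast
      ring
    rw [h2, integral_add (hexp _ hconj) (hexp _ hF.integrable), h1, hgF, hodd]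
    simp
  filter_upwards [ae_eq_zero_of_fourier_eq_zero (hconj.add hF.integrable) hfour] with t ht
  exact eq_neg_of_add_eq_zero_left ht

theorem IsFilterFunction.integral_eq_zero {F : ℝ → ℂ} (hF : IsFilterFunction F) :
    ∫ t, F t = 0 := by
  have h := integral_neg_eq_self F volume
  simp only [hF.odd, integral_neg] at h
  exact self_eq_neg.1 h.symm

end Filter

/-! ### Unitary evolution -/

section Evolution

variable {Λ : Type*} [Fintype Λ] [DecidableEq Λ] {q : Λ → ℕ}

/-- The Heisenberg evolution `exp(i H t) X exp(-i H t)`. -/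
def evol (H : Op q) (t : ℝ) (X : Op q) : Op q :=
  NormedSpace.exp ((Complex.I * (t : ℂ)) • H) * X * NormedSpace.exp (-((Complex.I * (t : ℂ)) • H))

theorem I_mul_neg_smul (H : Op q) (t : ℝ) :
    (Complex.I * ((-t : ℝ) : ℂ)) • H = -((Complex.I * (t : ℂ)) • H) := by
  rw [Complex.ofReal_neg, mul_neg]
  exact neg_smul _ H

theorem star_I_mul_smul {H : Op q} (hH : IsSelfAdjoint H) (t : ℝ) :
    star ((Complex.I * (t : ℂ)) • H) = -((Complex.I * (t : ℂ)) • H) := by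
  rw [← I_mul_neg_smul, star_smul, hH.star_eq]
  simp

theorem exp_I_smul_mem_unitary {H : Op q} (hH : IsSelfAdjoint H) (t : ℝ) :
    NormedSpace.exp ((Complex.I * (t : ℂ)) • H) ∈ unitary (Op q) := by
  let _ : NormedAlgebra ℚ (Op q) := NormedAlgebra.restrictScalars ℚ ℂ (Op q)
  exact NormedSpace.exp_mem_unitary_of_mem_skewAdjoint
    (skewAdjoint.mem_iff.2 (star_I_mul_smul hH t))

theorem exp_neg_I_smul {H : Op q} (hH : IsSelfAdjoint H) (t : ℝ) :
    NormedSpace.exp (-((Complex.I * (t : ℂ)) • H)) =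
      star (NormedSpace.exp ((Complex.I * (t : ℂ)) • H)) := by
  rw [← star_I_mul_smul hH]
  exact (NormedSpace.star_exp _).symm

theorem evol_eq {H : Op q} (hH : IsSelfAdjoint H) (t : ℝ) (X : Op q) :
    evol H t X = NormedSpace.exp ((Complex.I * (t : ℂ)) • H) * X *
      star (NormedSpace.exp ((Complex.I * (t : ℂ)) • H)) := by
  rw [evol, exp_neg_I_smul hH]

theorem norm_evol {H : Op q} (hH : IsSelfAdjoint H) (t : ℝ) (X : Op q) :
    ‖evol H t X‖ = ‖X‖ := by
  rw [evol_eq hH, norm_mul_mul_star (exp_I_smul_mem_unitary hH t)]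

theorem isSelfAdjoint_evol {H X : Op q} (hH : IsSelfAdjoint H) (hX : IsSelfAdjoint X) (t : ℝ) :
    IsSelfAdjoint (evol H t X) := by
  rw [evol_eq hH]
  exact hX.conjugate _

theorem evol_of_commute {H X : Op q} (hH : IsSelfAdjoint H) (hX : ∀ Y : Op q, X * Y = Y * X)
    (t : ℝ) : evol H t X = X := by
  rw [evol_eq hH, ← hX, mul_assoc, Unitary.mul_star_self_of_mem (exp_I_smul_mem_unitary hH t),
    mul_one]

theorem evol_sum {ι : Type*} (s : Finset ι) (H : Op q) (t : ℝ) (X : ι → Op q) :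
    evol H t (∑ i ∈ s, X i) = ∑ i ∈ s, evol H t (X i) := by
  simp only [evol, Finset.mul_sum, Finset.sum_mul]

theorem continuous_evol {H : ℝ → Op q} (hH : Continuous H) (X : Op q) :
    Continuous fun p : ℝ × ℝ => evol (H p.1) p.2 X := by
  let _ : NormedAlgebra ℚ (Op q) := NormedAlgebra.restrictScalars ℚ ℂ (Op q)
  have h1 : Continuous fun p : ℝ × ℝ => (Complex.I * (p.2 : ℂ)) • H p.1 := by fun_prop
  have h2 : Continuous fun p : ℝ × ℝ => NormedSpace.exp ((Complex.I * (p.2 : ℂ)) • H p.1) :=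
    NormedSpace.exp_continuous.comp h1
  have h3 : Continuous fun p : ℝ × ℝ => NormedSpace.exp (-((Complex.I * (p.2 : ℂ)) • H p.1)) :=
    NormedSpace.exp_continuous.comp h1.neg
  exact (h2.mul continuous_const).mul h3

theorem continuous_evol_time (H X : Op q) : Continuous fun t : ℝ => evol H t X := by
  have h := continuous_evol (H := fun _ => H) continuous_const X
  have h2 : Continuous fun t : ℝ => ((0 : ℝ), t) := by fun_prop
  exact (h.comp h2 :)

theorem hasDerivAt_exp_I_smul (D : Op q) (t : ℝ) :
    HasDerivAt (fun t : ℝ => NormedSpace.exp ((Complex.I * (t : ℂ)) • D))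
      (Complex.I • (D * NormedSpace.exp ((Complex.I * (t : ℂ)) • D))) t := by
  have e : ∀ t : ℝ, (Complex.I * (t : ℂ)) • D = t • (Complex.I • D) := fun t => by
    rw [mul_comm, mul_smul]
    rfl
  simp only [e]
  have h := hasDerivAt_exp_smul_const' (Complex.I • D) t
  rwa [smul_mul_assoc] at h

theorem evol_neg_time {H : Op q} (hH : IsSelfAdjoint H) (t : ℝ) (X : Op q) :
    star (NormedSpace.exp ((Complex.I * (t : ℂ)) • H)) * X *
      NormedSpace.exp ((Complex.I * (t : ℂ)) • H) = evol H (-t) X := by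
  rw [evol, ← exp_neg_I_smul hH, I_mul_neg_smul, neg_neg]

theorem evol_neg_neg (H : Op q) (t : ℝ) (X : Op q) : evol (-H) (-t) X = evol H t X := by
  have h : (Complex.I * ((-t : ℝ) : ℂ)) • -H = (Complex.I * (t : ℂ)) • H := by
    rw [I_mul_neg_smul, ← neg_neg ((Complex.I * (t : ℂ)) • H)]
    exact congrArg Neg.neg (smul_neg _ H)
  rw [evol, evol, h]

end Evolution

/-! ### Interactions with exponential decay -/

section Static

variable {Λ : Type*} [Fintype Λ] [DecidableEq Λ] {q : Λ → ℕ}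

/-- The terms of a self-adjoint Hamiltonian may be replaced by their self-adjoint parts. -/
theorem exists_selfAdjoint_terms {Φ : Finset Λ → Op q} (h : ∀ Z, SupportedOn Z (Φ Z))
    (hsa : IsSelfAdjoint (∑ Z, Φ Z)) :
    ∃ Ψ : Finset Λ → Op q, (∀ Z, SupportedOn Z (Ψ Z)) ∧ (∀ Z, IsSelfAdjoint (Ψ Z)) ∧
      ∑ Z, Ψ Z = ∑ Z, Φ Z ∧ ∀ Z, ‖Ψ Z‖ ≤ ‖Φ Z‖ := by
  refine ⟨fun Z => (2⁻¹ : ℂ) • (Φ Z + star (Φ Z)), fun Z => ((h Z).add (h Z).star).smul _,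
    fun Z => ?_, ?_, fun Z => ?_⟩
  · exact IsSelfAdjoint.smul (by simp [IsSelfAdjoint]) (IsSelfAdjoint.add_star_self (Φ Z))
  · have h1 : ∑ Z, star (Φ Z) = ∑ Z, Φ Z := (star_sum (R := Op q) _ _).symm.trans hsa.star_eq
    have h2 : ∑ Z, (2⁻¹ : ℂ) • (Φ Z + star (Φ Z)) =
        (2⁻¹ : ℂ) • (∑ Z, Φ Z + ∑ Z, star (Φ Z)) := by
      rw [← Finset.sum_add_distrib, Finset.smul_sum]
    rw [h2, h1, ← two_smul ℂ, smul_smul]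
    norm_num
  · rw [norm_smul]
    have h1 := norm_add_le (Φ Z) (star (Φ Z))
    have h2 : ‖star (Φ Z)‖ = ‖Φ Z‖ := norm_star (Φ Z)
    norm_num
    linarith

omit [Fintype Λ] in
theorem sum_not_disjoint_le {ι : Type*} [Fintype ι] (supp : ι → Finset Λ) {f : ι → ℝ}
    (hf : ∀ i, 0 ≤ f i) (A : Finset Λ) :
    ∑ i with ¬Disjoint (supp i) A, f i ≤ ∑ x ∈ A, ∑ i with x ∈ supp i, f i := by
  rw [Finset.sum_filter]
  simp only [Finset.sum_filter (p := fun i => _ ∈ supp i)]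
  rw [Finset.sum_comm]
  refine Finset.sum_le_sum fun i _ => ?_
  have hnn : ∀ x, 0 ≤ if x ∈ supp i then f i else 0 := fun x => by
    split_ifs
    exacts [hf i, le_rfl]
  by_cases h : Disjoint (supp i) A
  · rw [if_neg (not_not.2 h)]
    exact Finset.sum_nonneg fun x _ => hnn x
  · rw [if_pos h]
    obtain ⟨x, hx, hxA⟩ := Finset.not_disjoint_iff.1 h
    have := Finset.single_le_sum (f := fun x => if x ∈ supp i then f i else 0)
      (fun x _ => hnn x) hxA
    rwa [if_pos hx] at this

variable [MetricSpace Λ]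

omit [Fintype Λ] [DecidableEq Λ] in
theorem setDist_nonneg (A B : Finset Λ) : 0 ≤ setDist A B := by
  refine Real.sInf_nonneg ?_
  rintro r ⟨x, -, y, -, rfl⟩
  exact dist_nonneg

omit [Fintype Λ] [DecidableEq Λ] in
theorem setDist_le_dist {A B : Finset Λ} {x y : Λ} (hx : x ∈ A) (hy : y ∈ B) :
    setDist A B ≤ dist x y :=
  csInf_le ⟨0, by rintro r ⟨x, -, y, -, rfl⟩; exact dist_nonneg⟩ ⟨x, hx, y, hy, rfl⟩

omit [Fintype Λ] [DecidableEq Λ] in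
theorem le_setDist {A B : Finset Λ} (hA : A.Nonempty) (hB : B.Nonempty) {r : ℝ}
    (h : ∀ x ∈ A, ∀ y ∈ B, r ≤ dist x y) : r ≤ setDist A B := by
  obtain ⟨x, hx⟩ := hA
  obtain ⟨y, hy⟩ := hB
  refine le_csInf ⟨_, x, hx, y, hy, rfl⟩ ?_
  rintro r ⟨x, hx, y, hy, rfl⟩
  exact h x hx y hy

/-- The weight of a region for exponentially decaying interactions. -/
def expWeight (μ : ℝ) (B A : Finset Λ) : ℝ :=
  ∑ x ∈ A, Real.exp (-μ * Metric.infDist x (B : Set Λ))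

omit [Fintype Λ] [DecidableEq Λ] in
theorem expWeight_le {μ : ℝ} (hμ : 0 ≤ μ) {A B : Finset Λ} (hB : B.Nonempty) :
    expWeight μ B A ≤ A.card * Real.exp (-μ * setDist A B) := by
  rw [expWeight, ← nsmul_eq_mul]
  refine Finset.sum_le_card_nsmul _ _ _ fun x hx => Real.exp_le_exp.2 ?_
  have h : setDist A B ≤ Metric.infDist x (B : Set Λ) :=
    (Metric.le_infDist (by exact_mod_cast hB)).2 fun {y} hy => setDist_le_dist hx (by
      exact_mod_cast hy)
  nlinarith

theorem sum_norm_mul_expWeight_le {μ K : ℝ} (hμ : 0 ≤ μ) {f : Finset Λ → ℝ} (hf : ∀ Z, 0 ≤ f Z)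
    (hK : ∀ u : Λ, ∑ Z with u ∈ Z, f Z * Z.card * Real.exp (μ * Metric.diam (Z : Set Λ)) ≤ K)
    (A B : Finset Λ) :
    ∑ Z with ¬Disjoint Z A, f Z * expWeight μ B Z ≤ K * expWeight μ B A := by
  have hw : ∀ Z, 0 ≤ expWeight μ B Z := fun Z => Finset.sum_nonneg fun x _ => (Real.exp_pos _).le
  refine (sum_not_disjoint_le (fun Z => Z) (fun Z => mul_nonneg (hf Z) (hw Z)) A).trans ?_
  rw [expWeight, Finset.mul_sum]
  refine Finset.sum_le_sum fun x _ => ?_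
  refine le_trans ?_ (mul_le_mul_of_nonneg_right (hK x) (Real.exp_pos _).le)
  rw [Finset.sum_mul]
  refine Finset.sum_le_sum fun Z hZ => ?_
  have hx : x ∈ Z := (Finset.mem_filter.1 hZ).2
  rw [mul_assoc, mul_assoc]
  refine mul_le_mul_of_nonneg_left ?_ (hf Z)
  rw [expWeight, ← nsmul_eq_mul]
  refine Finset.sum_le_card_nsmul _ _ _ fun z hz => ?_
  rw [← Real.exp_add]
  refine Real.exp_le_exp.2 ?_
  have h1 : Metric.infDist x (B : Set Λ) ≤ Metric.infDist z (B : Set Λ) + dist x z :=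
    Metric.infDist_le_infDist_add_dist
  have h2 : dist x z ≤ Metric.diam (Z : Set Λ) :=
    Metric.dist_le_diam_of_mem Z.finite_toSet.isBounded (by exact_mod_cast hx)
      (by exact_mod_cast hz)
  nlinarith

/-- Lieb-Robinson bound for a time-independent Hamiltonian and positive times. -/
theorem norm_lie_star_exp_le {μ K : ℝ} (hμ : 0 ≤ μ) (hK0 : 0 ≤ K) {Φ : Finset Λ → Op q}
    (hsupp : ∀ Z, SupportedOn Z (Φ Z)) (hsa : ∀ Z, IsSelfAdjoint (Φ Z))
    (hK : ∀ u : Λ, ∑ Z with u ∈ Z, ‖Φ Z‖ * Z.card * Real.exp (μ * Metric.diam (Z : Set Λ)) ≤ K)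
    {A B : Finset Λ} {O P : Op q} (hO : SupportedOn A O) (hP : SupportedOn B P) {t : ℝ}
    (ht : 0 ≤ t) :
    ‖⁅evol (∑ Z, Φ Z) (-t) O, P⁆‖ ≤
      4 * Real.exp (4 * K * t) * expWeight μ B A * ‖O‖ * ‖P‖ := by
  rw [← evol_neg_time (isSelfAdjoint_sum (R := Op q) _ fun Z _ => hsa Z)]
  refine lieb_robinson (supp := fun Z => Z) (Φ := fun _ => Φ) (T := t)
    (U := fun t => NormedSpace.exp ((Complex.I * (t : ℂ)) • ∑ Z, Φ Z)) (fun _ => continuous_const)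
    (fun _ => hsa) (fun _ => hsupp) (hasDerivAt_exp_I_smul _) ?_ hP
    (fun A => Finset.sum_nonneg fun x _ => (Real.exp_pos _).le)
    (fun A hA => Finset.sum_pos (fun x _ => Real.exp_pos _) hA) (fun A hA => ?_) hK0
    (fun _ _ A => sum_norm_mul_expWeight_le hμ (fun Z => norm_nonneg (Φ Z)) hK A B) hO ⟨ht, le_rfl⟩
  · have h0 : (Complex.I * ((0 : ℝ) : ℂ)) • ∑ Z, Φ Z = 0 := by
      rw [Complex.ofReal_zero, mul_zero]
      exact zero_smul ℂ (∑ Z, Φ Z)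
    rw [h0]
    exact NormedSpace.exp_zero
  · obtain ⟨x, hxA, hxB⟩ := Finset.not_disjoint_iff.1 hA
    have h := Finset.single_le_sum (f := fun x => Real.exp (-μ * Metric.infDist x (B : Set Λ)))
      (fun x _ => (Real.exp_pos _).le) hxA
    have h0 : Metric.infDist x (B : Set Λ) = 0 :=
      Metric.infDist_zero_of_mem (by exact_mod_cast hxB)
    simpa only [h0, mul_zero, Real.exp_zero] using h

/-- Lieb-Robinson bound for a time-independent Hamiltonian. The terms of the decomposition need
not be self-adjoint. -/
theorem IsLocalDecomposition.norm_lie_evol_le {μ K : ℝ} (hμ : 0 ≤ μ) (hK0 : 0 ≤ K)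
    {Φ : Finset Λ → Op q} (hΦ : IsLocalDecomposition μ K Φ) {A B : Finset Λ} {O P : Op q}
    (hO : SupportedOn A O) (hP : SupportedOn B P) (t : ℝ) :
    ‖⁅evol (∑ Z, Φ Z) t O, P⁆‖ ≤
      4 * Real.exp (4 * K * |t|) * expWeight μ B A * ‖O‖ * ‖P‖ := by
  obtain ⟨Ψ, hsupp, hsa, hsum, hnorm⟩ := exists_selfAdjoint_terms hΦ.supported hΦ.selfAdjoint
  have hK : ∀ u : Λ,
      ∑ Z with u ∈ Z, ‖Ψ Z‖ * Z.card * Real.exp (μ * Metric.diam (Z : Set Λ)) ≤ K := fun u =>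
    (Finset.sum_le_sum fun Z _ => by gcongr; exact hnorm Z).trans (hΦ.decay u)
  rw [← hsum]
  rcases le_total 0 t with ht | ht
  · have hK' : ∀ u : Λ,
        ∑ Z with u ∈ Z, ‖-Ψ Z‖ * Z.card * Real.exp (μ * Metric.diam (Z : Set Λ)) ≤ K := by
      simpa only [norm_neg] using hK
    have hs' : ∀ Z, SupportedOn Z (-Ψ Z) := fun Z => by
      have h : -Ψ Z = (-1 : ℂ) • Ψ Z := (neg_one_smul ℂ (Ψ Z)).symm
      exact h ▸ (hsupp Z).smul (-1)
    have h := norm_lie_star_exp_le (Φ := fun Z => -Ψ Z) hμ hK0 hs'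
      (fun Z => IsSelfAdjoint.neg (R := Op q) (hsa Z)) hK' hO hP ht
    rw [Finset.sum_neg_distrib, evol_neg_neg] at h
    rwa [abs_of_nonneg ht]
  · have h := norm_lie_star_exp_le hμ hK0 hsupp hsa hK hO hP (neg_nonneg.2 ht)
    rw [neg_neg] at h
    rwa [abs_of_nonpos ht]

theorem IsLocalDecomposition.path {μ K J s : ℝ} (hs : |s| ≤ 1) {H₀ V : Finset Λ → Op q}
    (hH : IsLocalDecomposition μ K H₀) (hV : IsLocalDecomposition μ J V) :
    IsLocalDecomposition μ (K + J) (fun Z => H₀ Z + s • V Z) where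
  supported Z := (hH.supported Z).add ((hV.supported Z).smul (s : ℂ))
  selfAdjoint := by
    rw [Finset.sum_add_distrib, ← Finset.smul_sum]
    exact IsSelfAdjoint.add (R := Op q) hH.selfAdjoint
      (IsSelfAdjoint.smul (by simp [IsSelfAdjoint]) hV.selfAdjoint)
  decay u := by
    refine le_trans ?_ (add_le_add (hH.decay u) (hV.decay u))
    rw [← Finset.sum_add_distrib]
    refine Finset.sum_le_sum fun Z _ => ?_
    rw [← add_mul, ← add_mul]
    gcongr
    refine (norm_add_le _ _).trans (add_le_add le_rfl ?_)
    rw [norm_smul]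
    exact mul_le_of_le_one_left (norm_nonneg _) hs

end Static

/-! ### Filtered evolution -/

section Dressed

variable {Λ : Type*} [Fintype Λ] [DecidableEq Λ] {q : Λ → ℕ}

/-- The filtered evolution `i ∫ F(t) exp(i H t) X exp(-i H t) dt` of an operator `X`. -/
def dressed (F : ℝ → ℂ) (H X : Op q) : Op q :=
  Complex.I • ∫ t : ℝ, F t • evol H t X

variable {F : ℝ → ℂ} {H : Op q}

theorem integrable_smul_evol (hF : Integrable F) (hH : IsSelfAdjoint H) (X : Op q) :
    Integrable fun t => F t • evol H t X := by
  refine (hF.norm.mul_const ‖X‖).mono'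
    (hF.aestronglyMeasurable.smul (continuous_evol_time H X).aestronglyMeasurable)
    (Eventually.of_forall fun t => ?_)
  rw [norm_smul, norm_evol hH]

theorem dressed_sum (hF : Integrable F) (hH : IsSelfAdjoint H) {ι : Type*} (s : Finset ι)
    (X : ι → Op q) : dressed F H (∑ i ∈ s, X i) = ∑ i ∈ s, dressed F H (X i) := by
  simp only [dressed, evol_sum, Finset.smul_sum]
  rw [integral_finsetSum _ fun i _ => integrable_smul_evol hF hH (X i), Finset.smul_sum]

theorem norm_dressed_le (hH : IsSelfAdjoint H) (X : Op q) :
    ‖dressed F H X‖ ≤ (∫ t, ‖F t‖) * ‖X‖ := by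
  rw [dressed, norm_smul, Complex.norm_I, one_mul]
  refine (norm_integral_le_integral_norm _).trans_eq ?_
  rw [← integral_mul_const]
  refine integral_congr_ae (Eventually.of_forall fun t => ?_)
  simp only [norm_smul, norm_evol hH]

theorem dressed_eq_zero_of_commute (hF : IsFilterFunction F) (hH : IsSelfAdjoint H) {X : Op q}
    (hX : ∀ Y : Op q, X * Y = Y * X) : dressed F H X = 0 := by
  simp only [dressed, evol_of_commute hH hX]
  rw [integral_smul_const, hF.integral_eq_zero]
  have h : (0 : ℂ) • X = 0 := zero_smul ℂ X
  rw [h]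
  exact smul_zero (A := Op q) Complex.I

theorem isSelfAdjoint_dressed (hF : IsFilterFunction F) (hH : IsSelfAdjoint H) {X : Op q}
    (hX : IsSelfAdjoint X) : IsSelfAdjoint (dressed F H X) := by
  have e : dressed F H X = ∫ t : ℝ, (Complex.I * F t) • evol H t X := by
    rw [dressed, ← integral_smul]
    simp only [smul_smul]
  rw [e, IsSelfAdjoint]
  have h := ContinuousLinearEquiv.integral_comp_comm (μ := volume) (starL' ℝ : Op q ≃L[ℝ] Op q)
    fun t : ℝ => (Complex.I * F t) • evol H t X
  refine h.symm.trans (integral_congr_ae ?_)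
  filter_upwards [hF.ae_conj_eq_neg] with t ht
  change star ((Complex.I * F t) • evol H t X) = _
  rw [star_smul, (isSelfAdjoint_evol hH hX t).star_eq, star_mul', ht]
  simp

theorem continuous_dressed (hF : Integrable F) {H : ℝ → Op q} (hH : ∀ s, IsSelfAdjoint (H s))
    (hHc : Continuous H) (X : Op q) : Continuous fun s => dressed F (H s) X := by
  refine (continuous_of_dominated (bound := fun t => ‖F t‖ * ‖X‖)
    (fun s => (integrable_smul_evol hF (hH s) X).aestronglyMeasurable)
    (fun s => Eventually.of_forall fun t => ?_) (hF.norm.mul_const ‖X‖)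
    (Eventually.of_forall fun t => ?_)).const_smul Complex.I
  · rw [norm_smul, norm_evol (hH s)]
  · have h1 : Continuous fun s : ℝ => (s, t) := by fun_prop
    exact (((continuous_evol hHc X).comp h1).const_smul (F t) :)

theorem norm_lie_dressed_le (hF : IsFilterFunction F) (hH : IsSelfAdjoint H) {X P : Op q} {M : ℝ}
    {n : ℕ} (h : ∀ t : ℝ, ‖⁅evol H t X, P⁆‖ ≤ (1 + |t|) ^ n * M) :
    ‖⁅dressed F H X, P⁆‖ ≤ (∫ t : ℝ, ‖F t‖ * (1 + |t|) ^ n) * M := by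
  set L : Op q →L[ℂ] Op q :=
    (ContinuousLinearMap.mul ℂ (Op q)).flip P - ContinuousLinearMap.mul ℂ (Op q) P with hL
  have hLX : ∀ Y, L Y = ⁅Y, P⁆ := fun Y => rfl
  have h1 : ⁅dressed F H X, P⁆ = Complex.I • ∫ t : ℝ, F t • ⁅evol H t X, P⁆ := by
    rw [← hLX, dressed, map_smul, ← L.integral_comp_comm (integrable_smul_evol hF.integrable hH X)]
    exact congrArg _ (integral_congr_ae (Eventually.of_forall fun t => L.map_smul (F t) _))
  rw [h1, norm_smul, Complex.norm_I, one_mul, ← integral_mul_const]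
  refine norm_integral_le_of_norm_le ((hF.integrable_pow n).mul_const M)
    (Eventually.of_forall fun t => ?_)
  rw [norm_smul, mul_assoc]
  exact mul_le_mul_of_nonneg_left (h t) (norm_nonneg _)

theorem hasDerivAt_path (H₀ V : Finset Λ → Op q) (s : ℝ) :
    HasDerivAt (path H₀ V) (∑ Z, V Z) s := by
  have h := ((hasDerivAt_id s).smul_const (∑ Z, V Z)).const_add (∑ Z, H₀ Z)
  rwa [one_smul] at h

theorem continuous_path (H₀ V : Finset Λ → Op q) : Continuous (path H₀ V) :=
  continuous_iff_continuousAt.2 fun s => (hasDerivAt_path H₀ V s).continuousAt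

theorem isSelfAdjoint_path {H₀ V : Finset Λ → Op q} (hH : IsSelfAdjoint (∑ Z, H₀ Z))
    (hV : IsSelfAdjoint (∑ Z, V Z)) (s : ℝ) : IsSelfAdjoint (path H₀ V s) :=
  IsSelfAdjoint.add (R := Op q) hH
    (IsSelfAdjoint.smul (r := (s : ℂ)) (by simp [IsSelfAdjoint]) hV)

theorem path_eq_sum (H₀ V : Finset Λ → Op q) (s : ℝ) :
    path H₀ V s = ∑ Z, (H₀ Z + s • V Z) := by
  rw [path, Finset.sum_add_distrib, Finset.smul_sum]

theorem generator_eq_dressed (F : ℝ → ℂ) (H₀ V : Finset Λ → Op q) (s : ℝ) :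
    generator F (path H₀ V) s = dressed F (path H₀ V s) (∑ Z, V Z) := by
  rw [generator, (hasDerivAt_path H₀ V s).deriv]
  rfl

end Dressed

/-! ### Locality of the filtered evolution -/

theorem exists_one_add_pow_le_exp {a : ℝ} (ha : 0 < a) (n : ℕ) :
    ∃ c, 0 ≤ c ∧ ∀ l : ℝ, 0 ≤ l → (1 + l) ^ n ≤ c * Real.exp (a * l) := by
  refine ⟨n.factorial * Real.exp a / a ^ n, by positivity, fun l hl => ?_⟩
  have h := Real.pow_div_factorial_le_exp (x := a * (1 + l)) (by positivity) n
  rw [div_le_iff₀ (by positivity), mul_pow, mul_add, mul_one, Real.exp_add] at h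
  rw [div_mul_eq_mul_div, le_div_iff₀ (by positivity)]
  linarith

/-- The Lieb-Robinson bound inside the light cone, and the trivial bound outside it, are both
controlled by any power of the ratio of time and distance. -/
theorem exists_min_exp_le_pow {μ K : ℝ} (hμ : 0 < μ) (hK : 0 ≤ K) (n : ℕ) :
    ∃ c, 0 ≤ c ∧ ∀ l τ : ℝ, 0 ≤ l → 0 ≤ τ →
      min 2 (4 * Real.exp (4 * K * τ) * Real.exp (-μ * l)) ≤ (1 + τ) ^ n * (c / (1 + l) ^ n) := by
  obtain ⟨c, hc0, hc⟩ := exists_one_add_pow_le_exp (half_pos hμ) n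
  set b : ℝ := 1 + 8 * K / μ with hb
  have hb1 : 1 ≤ b := by
    rw [hb]
    have : 0 ≤ 8 * K / μ := by positivity
    linarith
  refine ⟨4 * c + 2 * b ^ n, by positivity, fun l τ hl hτ => ?_⟩
  rw [← mul_div_assoc, le_div_iff₀ (by positivity)]
  have h1 : 1 ≤ (1 + τ) ^ n := one_le_pow₀ (by linarith)
  rcases le_total (8 * K * τ) (μ * l) with h | h
  · calc _ ≤ (4 * Real.exp (4 * K * τ) * Real.exp (-μ * l)) * (1 + l) ^ n :=
          mul_le_mul_of_nonneg_right (min_le_right _ _) (by positivity)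
      _ ≤ (4 * Real.exp (4 * K * τ) * Real.exp (-μ * l)) * (c * Real.exp (μ / 2 * l)) :=
          mul_le_mul_of_nonneg_left (hc l hl) (by positivity)
      _ = 4 * c * Real.exp (4 * K * τ + -μ * l + μ / 2 * l) := by
          rw [Real.exp_add, Real.exp_add]
          ring
      _ ≤ 4 * c * 1 := by
          refine mul_le_mul_of_nonneg_left (Real.exp_le_one_iff.2 ?_) (by positivity)
          linarith
      _ ≤ 1 * (4 * c + 2 * b ^ n) := by
          have : 0 ≤ b ^ n := by positivity
          linarith
      _ ≤ _ := mul_le_mul_of_nonneg_right h1 (by positivity)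
  · have h2 : 1 + l ≤ b * (1 + τ) := by
      have h3 : l ≤ 8 * K / μ * τ := by
        rw [div_mul_eq_mul_div, le_div_iff₀ hμ]
        linarith
      have : 0 ≤ 8 * K / μ := by positivity
      rw [hb]
      nlinarith
    calc _ ≤ 2 * (1 + l) ^ n := mul_le_mul_of_nonneg_right (min_le_left _ _) (by positivity)
      _ ≤ 2 * (b * (1 + τ)) ^ n := by gcongr
      _ = (1 + τ) ^ n * (2 * b ^ n) := by rw [mul_pow]; ring
      _ ≤ _ := mul_le_mul_of_nonneg_left (by linarith) (by positivity)

/-- Filtered evolution of a local operator is local up to tails that decay faster than any power,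
uniformly in the system. -/
theorem exists_norm_lie_dressed_le {F : ℝ → ℂ} (hF : IsFilterFunction F) {μ K : ℝ} (hμ : 0 < μ)
    (hK : 0 ≤ K) (n : ℕ) :
    ∃ c, 0 ≤ c ∧ ∀ (Λ : Type*) [Fintype Λ] [DecidableEq Λ] [MetricSpace Λ] (q : Λ → ℕ)
      (Φ : Finset Λ → Op q), IsLocalDecomposition μ K Φ →
      ∀ (Z B : Finset Λ) (X P : Op q), SupportedOn Z X → SupportedOn B P →
        ‖⁅dressed F (∑ Z, Φ Z) X, P⁆‖ ≤ c / (1 + setDist Z B) ^ n * (Z.card * ‖X‖ * ‖P‖) := by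
  obtain ⟨c, hc0, hc⟩ := exists_min_exp_le_pow hμ hK n
  have hI : 0 ≤ ∫ t : ℝ, ‖F t‖ * (1 + |t|) ^ n := integral_nonneg fun t => by positivity
  refine ⟨(∫ t : ℝ, ‖F t‖ * (1 + |t|) ^ n) * c, by positivity, ?_⟩
  intro Λ _ _ _ q Φ hΦ Z B X P hX hP
  have hl := setDist_nonneg Z B
  have hM : 0 ≤ c / (1 + setDist Z B) ^ n * (Z.card * ‖X‖ * ‖P‖) := by positivity
  have hpt : ∀ t : ℝ, ‖⁅evol (∑ Z, Φ Z) t X, P⁆‖ ≤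
      (1 + |t|) ^ n * (c / (1 + setDist Z B) ^ n * (Z.card * ‖X‖ * ‖P‖)) := by
    intro t
    rcases B.eq_empty_or_nonempty with rfl | hB
    · rw [(supportedOn_univ _).lie_eq_zero hP (Finset.disjoint_empty_right _), norm_zero]
      positivity
    have h1 := hΦ.norm_lie_evol_le hμ.le hK hX hP t
    rcases Z.eq_empty_or_nonempty with rfl | hZ
    · refine h1.trans ?_
      simp [expWeight]
    have hZ1 : (1 : ℝ) ≤ Z.card := by exact_mod_cast hZ.card_pos
    have h2 : ‖⁅evol (∑ Z, Φ Z) t X, P⁆‖ ≤ 2 * (Z.card * ‖X‖ * ‖P‖) := by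
      refine (norm_lie_le_two_mul _ _).trans ?_
      rw [norm_evol hΦ.selfAdjoint]
      have := mul_le_mul_of_nonneg_right hZ1 (by positivity : 0 ≤ 2 * ‖X‖ * ‖P‖)
      linarith
    have h3 : ‖⁅evol (∑ Z, Φ Z) t X, P⁆‖ ≤
        4 * Real.exp (4 * K * |t|) * Real.exp (-μ * setDist Z B) * (Z.card * ‖X‖ * ‖P‖) := by
      refine h1.trans ?_
      have h4 := mul_le_mul_of_nonneg_left (expWeight_le hμ.le hB (A := Z))
        (by positivity : 0 ≤ 4 * Real.exp (4 * K * |t|) * (‖X‖ * ‖P‖))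
      linarith
    have h5 : ‖⁅evol (∑ Z, Φ Z) t X, P⁆‖ ≤
        min 2 (4 * Real.exp (4 * K * |t|) * Real.exp (-μ * setDist Z B)) *
          (Z.card * ‖X‖ * ‖P‖) := by
      rw [min_mul_of_nonneg _ _ (by positivity)]
      exact le_min h2 h3
    refine h5.trans ((mul_le_mul_of_nonneg_right (hc _ |t| hl (abs_nonneg t))
      (by positivity)).trans_eq (by ring))
  refine (norm_lie_dressed_le hF hΦ.selfAdjoint hpt).trans_eq ?_
  ring

/-! ### Polynomial weights on lattices of finite dimension -/

section Geometry

theorem exists_sum_inv_sq_le : ∃ c : ℝ, 0 ≤ c ∧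
    ∀ N : ℕ, ∑ n ∈ Finset.range N, ((1 + (n : ℝ)) ^ 2)⁻¹ ≤ c := by
  have hs : Summable fun n : ℕ => ((1 + (n : ℝ)) ^ 2)⁻¹ := by
    have h := (summable_nat_add_iff 1).2 (Real.summable_nat_pow_inv.2 (one_lt_two (α := ℕ)))
    refine h.congr fun n => ?_
    push_cast
    rw [add_comm]
  exact ⟨_, tsum_nonneg fun n => by positivity, fun N =>
    hs.sum_le_tsum _ fun n _ => by positivity⟩

variable {Λ : Type*} [Fintype Λ] [MetricSpace Λ] {D : ℕ} {κ : ℝ}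

theorem HasDimension.nonneg (h : HasDimension Λ D κ) (u : Λ) : 0 ≤ κ := by
  have h1 := h u 0 le_rfl
  rw [add_zero, one_pow, mul_one] at h1
  exact le_trans (Nat.cast_nonneg _) h1

theorem HasDimension.card_le (h : HasDimension Λ D κ) (u : Λ) {r : ℝ} (hr : 0 ≤ r) :
    ((Finset.univ.filter fun v => dist u v ≤ r).card : ℝ) ≤ κ * (1 + r) ^ D := by
  refine le_trans (le_of_eq ?_) (h u r hr)
  rw [Nat.card_eq_fintype_card, Fintype.card_subtype]

/-- The sums of `(1 + d(x, z)) ^ (-(D + 2))` over the lattice are bounded uniformly. -/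
theorem exists_sum_inv_pow_le (D : ℕ) (κ : ℝ) : ∃ S : ℝ, 0 ≤ S ∧
    ∀ (Λ : Type*) [Fintype Λ] [MetricSpace Λ], HasDimension Λ D κ → ∀ x : Λ,
      ∑ z, ((1 + dist x z) ^ (D + 2))⁻¹ ≤ S := by
  obtain ⟨c, hc0, hc⟩ := exists_sum_inv_sq_le
  refine ⟨|κ| * 2 ^ D * c, by positivity, fun Λ _ _ h x => ?_⟩
  have hκ : |κ| = κ := abs_of_nonneg (h.nonneg x)
  rw [hκ]
  -- Decompose the lattice into shells `n ≤ d(x, z) < n + 1`.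
  obtain ⟨N, hN⟩ : ∃ N : ℕ, ∀ z : Λ, ⌊dist x z⌋₊ < N :=
    ⟨Finset.univ.sup (fun z : Λ => ⌊dist x z⌋₊) + 1, fun z =>
      Nat.lt_succ_of_le (Finset.le_sup (f := fun z : Λ => ⌊dist x z⌋₊) (Finset.mem_univ z))⟩
  have h1 : ∀ z : Λ, ((1 + dist x z) ^ (D + 2))⁻¹ ≤ ∑ n ∈ Finset.range N,
      if dist x z ≤ n + 1 then ((1 + (n : ℝ)) ^ (D + 2))⁻¹ else 0 := fun z => by
    have h2 : (if dist x z ≤ (⌊dist x z⌋₊ : ℝ) + 1 then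
        ((1 + (⌊dist x z⌋₊ : ℝ)) ^ (D + 2))⁻¹ else 0) ≤ _ :=
      Finset.single_le_sum (f := fun n : ℕ => if dist x z ≤ (n : ℝ) + 1 then
        ((1 + (n : ℝ)) ^ (D + 2))⁻¹ else 0) (fun n _ => by split_ifs <;> positivity)
        (Finset.mem_range.2 (hN z))
    rw [if_pos (Nat.lt_floor_add_one _).le] at h2
    refine le_trans ?_ h2
    have h3 := Nat.floor_le (dist_nonneg (x := x) (y := z))
    gcongr
  calc ∑ z, ((1 + dist x z) ^ (D + 2))⁻¹
      ≤ ∑ z, ∑ n ∈ Finset.range N,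
          if dist x z ≤ n + 1 then ((1 + (n : ℝ)) ^ (D + 2))⁻¹ else 0 :=
        Finset.sum_le_sum fun z _ => h1 z
    _ = ∑ n ∈ Finset.range N, ((Finset.univ.filter fun z => dist x z ≤ (n : ℝ) + 1).card : ℝ) *
          ((1 + (n : ℝ)) ^ (D + 2))⁻¹ := by
        rw [Finset.sum_comm]
        refine Finset.sum_congr rfl fun n _ => ?_
        rw [← Finset.sum_filter, Finset.sum_const, nsmul_eq_mul]
    _ ≤ ∑ n ∈ Finset.range N, κ * 2 ^ D * ((1 + (n : ℝ)) ^ 2)⁻¹ := by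
        refine Finset.sum_le_sum fun n _ => ?_
        have h2 := h.card_le x (by positivity : (0 : ℝ) ≤ (n : ℝ) + 1)
        have h3 : (1 + ((n : ℝ) + 1)) ^ D ≤ 2 ^ D * (1 + (n : ℝ)) ^ D := by
          rw [← mul_pow]
          gcongr
          linarith [(Nat.cast_nonneg n : (0 : ℝ) ≤ n)]
        have h4 := h2.trans (mul_le_mul_of_nonneg_left h3 (h.nonneg x))
        refine (mul_le_mul_of_nonneg_right h4 (by positivity)).trans_eq ?_
        rw [pow_add]
        field_simp
    _ ≤ κ * 2 ^ D * c := by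
        rw [← Finset.mul_sum]
        have := h.nonneg x
        exact mul_le_mul_of_nonneg_left (hc N) (by positivity)

/-- The weight of a region for polynomially decaying interactions. -/
def polyWeight (p : ℕ) (B A : Finset Λ) : ℝ :=
  ∑ x ∈ A, ∑ y ∈ B, ((1 + dist x y) ^ p)⁻¹

omit [Fintype Λ] in
theorem polyWeight_comm (p : ℕ) (A B : Finset Λ) : polyWeight p B A = polyWeight p A B := by
  rw [polyWeight, polyWeight, Finset.sum_comm]
  simp only [dist_comm]

omit [Fintype Λ] in
theorem polyWeight_nonneg (p : ℕ) (A B : Finset Λ) : 0 ≤ polyWeight p B A :=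
  Finset.sum_nonneg fun x _ => Finset.sum_nonneg fun y _ => by positivity

theorem polyWeight_le {S : ℝ} (hS : ∀ x : Λ, ∑ z, ((1 + dist x z) ^ (D + 2))⁻¹ ≤ S)
    (m : ℕ) (A B : Finset Λ) :
    polyWeight (m + (D + 2)) B A ≤ S / (1 + setDist A B) ^ m * A.card := by
  have hd := setDist_nonneg A B
  rw [polyWeight, mul_comm, ← nsmul_eq_mul]
  refine Finset.sum_le_card_nsmul _ _ _ fun x hx => ?_
  calc ∑ y ∈ B, ((1 + dist x y) ^ (m + (D + 2)))⁻¹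
      ≤ ∑ y ∈ B, ((1 + setDist A B) ^ m)⁻¹ * ((1 + dist x y) ^ (D + 2))⁻¹ := by
        refine Finset.sum_le_sum fun y hy => ?_
        rw [pow_add, mul_inv]
        have := setDist_le_dist hx hy
        gcongr
    _ ≤ ((1 + setDist A B) ^ m)⁻¹ * ∑ y, ((1 + dist x y) ^ (D + 2))⁻¹ := by
        rw [← Finset.mul_sum]
        refine mul_le_mul_of_nonneg_left ?_ (by positivity)
        exact Finset.sum_le_univ_sum_of_nonneg fun y => by positivity
    _ ≤ S / (1 + setDist A B) ^ m := by
        rw [div_eq_inv_mul]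
        exact mul_le_mul_of_nonneg_left (hS x) (by positivity)

/-- Polynomial weights are reproduced by convolution. -/
theorem sum_inv_pow_mul_inv_pow_le {S : ℝ}
    (hS : ∀ x : Λ, ∑ z, ((1 + dist x z) ^ (D + 2))⁻¹ ≤ S) {p : ℕ} (hp : D + 2 ≤ p) (x y : Λ) :
    ∑ z, ((1 + dist x z) ^ p)⁻¹ * ((1 + dist z y) ^ p)⁻¹ ≤
      2 ^ (p + 1) * S * ((1 + dist x y) ^ p)⁻¹ := by
  have hmono : ∀ r : ℝ, 0 ≤ r → ((1 + r) ^ p)⁻¹ ≤ ((1 + r) ^ (D + 2))⁻¹ := fun r hr => by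
    gcongr
    linarith
  have key : ∀ a b d : ℝ, 0 ≤ a → 0 ≤ b → 0 ≤ d → d ≤ a + b →
      ((1 + a) ^ p)⁻¹ * ((1 + b) ^ p)⁻¹ ≤ 2 ^ p * ((1 + d) ^ p)⁻¹ *
        (((1 + a) ^ (D + 2))⁻¹ + ((1 + b) ^ (D + 2))⁻¹) := by
    -- The larger of the two distances is at least half of the total one.
    have aux : ∀ a b d : ℝ, 0 ≤ a → 0 ≤ b → 0 ≤ d → d ≤ a + b → b ≤ a →
        ((1 + a) ^ p)⁻¹ * ((1 + b) ^ p)⁻¹ ≤ 2 ^ p * ((1 + d) ^ p)⁻¹ *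
          (((1 + a) ^ (D + 2))⁻¹ + ((1 + b) ^ (D + 2))⁻¹) := by
      intro a b d ha hb hd hab hba
      have h1 : ((1 + a) ^ p)⁻¹ ≤ 2 ^ p * ((1 + d) ^ p)⁻¹ := by
        rw [← div_eq_mul_inv, le_div_iff₀ (by positivity), ← div_eq_inv_mul,
          div_le_iff₀ (by positivity), ← mul_pow]
        exact pow_le_pow_left₀ (by positivity) (by linarith) p
      refine mul_le_mul h1 ((hmono b hb).trans ?_) (by positivity) (by positivity)
      linarith [(by positivity : 0 ≤ ((1 + a) ^ (D + 2))⁻¹)]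
    intro a b d ha hb hd hab
    rcases le_total b a with h | h
    · exact aux a b d ha hb hd hab h
    · rw [mul_comm (((1 + a) ^ p)⁻¹), add_comm (((1 + a) ^ (D + 2))⁻¹)]
      exact aux b a d hb ha hd (by linarith) h
  calc ∑ z, ((1 + dist x z) ^ p)⁻¹ * ((1 + dist z y) ^ p)⁻¹
      ≤ ∑ z, 2 ^ p * ((1 + dist x y) ^ p)⁻¹ *
          (((1 + dist x z) ^ (D + 2))⁻¹ + ((1 + dist y z) ^ (D + 2))⁻¹) :=
        Finset.sum_le_sum fun z _ => by
          rw [dist_comm y z]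
          exact key _ _ _ dist_nonneg dist_nonneg dist_nonneg (dist_triangle x z y)
    _ ≤ 2 ^ p * ((1 + dist x y) ^ p)⁻¹ * (S + S) := by
        rw [← Finset.mul_sum, Finset.sum_add_distrib]
        exact mul_le_mul_of_nonneg_left (add_le_add (hS x) (hS y)) (by positivity)
    _ = _ := by ring

variable [DecidableEq Λ]

theorem sum_mul_polyWeight_le {S : ℝ} (hS : ∀ x : Λ, ∑ z, ((1 + dist x z) ^ (D + 2))⁻¹ ≤ S)
    {p : ℕ} (hp : D + 2 ≤ p) {ι : Type*} [Fintype ι] (supp : ι → Finset Λ) {f : ι → ℝ}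
    (hf : ∀ i, 0 ≤ f i) {c : ℝ} (hc : 0 ≤ c)
    (hfc : ∀ x z, ∑ i with x ∈ supp i ∧ z ∈ supp i, f i ≤ c * ((1 + dist x z) ^ p)⁻¹)
    (A B : Finset Λ) :
    ∑ i with ¬Disjoint (supp i) A, f i * polyWeight p B (supp i) ≤
      c * (2 ^ (p + 1) * S) * polyWeight p B A := by
  refine (sum_not_disjoint_le supp
    (fun i => mul_nonneg (hf i) (polyWeight_nonneg p _ _)) A).trans ?_
  rw [polyWeight, Finset.mul_sum]
  refine Finset.sum_le_sum fun x _ => ?_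
  set g : Λ → ℝ := fun z => ∑ y ∈ B, ((1 + dist z y) ^ p)⁻¹ with hg
  have hg0 : ∀ z, 0 ≤ g z := fun z => Finset.sum_nonneg fun y _ => by positivity
  calc ∑ i with x ∈ supp i, f i * polyWeight p B (supp i)
      = ∑ z, (∑ i with x ∈ supp i ∧ z ∈ supp i, f i) * g z := by
        simp only [polyWeight, Finset.mul_sum (s := supp _), Finset.sum_mul]
        simp only [Finset.sum_filter]
        rw [Finset.sum_comm]
        refine Finset.sum_congr rfl fun i _ => ?_
        by_cases hx : x ∈ supp i
        · simp only [hx, true_and, if_true, Finset.sum_ite_mem,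
            Finset.univ_inter, hg, Finset.mul_sum]
        · simp [hx]
    _ ≤ ∑ z, c * ((1 + dist x z) ^ p)⁻¹ * g z :=
        Finset.sum_le_sum fun z _ => mul_le_mul_of_nonneg_right (hfc x z) (hg0 z)
    _ = c * ∑ y ∈ B, ∑ z, ((1 + dist x z) ^ p)⁻¹ * ((1 + dist z y) ^ p)⁻¹ := by
        rw [Finset.sum_comm, Finset.mul_sum]
        refine Finset.sum_congr rfl fun z _ => ?_
        rw [hg, Finset.mul_sum, Finset.mul_sum]
        exact Finset.sum_congr rfl fun y _ => by ring
    _ ≤ c * ∑ y ∈ B, 2 ^ (p + 1) * S * ((1 + dist x y) ^ p)⁻¹ :=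
        mul_le_mul_of_nonneg_left
          (Finset.sum_le_sum fun y _ => sum_inv_pow_mul_inv_pow_le hS hp x y) hc
    _ = c * (2 ^ (p + 1) * S) * g x := by
        rw [hg, ← Finset.mul_sum]
        ring

end Geometry

/-! ### Decomposition of quasi-local operators into local ones -/

section Annular

variable {Λ : Type*} [Fintype Λ] [DecidableEq Λ] [MetricSpace Λ] {q : Λ → ℕ}

/-- The set of sites at distance at most `n` from `Z`. -/
def fatten (Z : Finset Λ) (n : ℕ) : Finset Λ :=
  Finset.univ.filter fun x => ∃ z ∈ Z, dist x z ≤ n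

omit [DecidableEq Λ] in
theorem mem_fatten {Z : Finset Λ} {n : ℕ} {x : Λ} :
    x ∈ fatten Z n ↔ ∃ z ∈ Z, dist x z ≤ n := by
  simp [fatten]

/-- The part of the operator `X` localized to the `n`-fattening of `Z` but not to the
`(n - 1)`-fattening. -/
def annular (Z : Finset Λ) (X : Op q) : ℕ → Op q
  | 0 => localize (fatten Z 0) X
  | n + 1 => localize (fatten Z (n + 1)) X - localize (fatten Z n) X

theorem supportedOn_annular (Z : Finset Λ) (X : Op q) (n : ℕ) :
    SupportedOn (fatten Z n) (annular Z X n) := by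
  cases n with
  | zero => exact supportedOn_localize _ _
  | succ n =>
    refine (supportedOn_localize _ _).sub ((supportedOn_localize _ _).mono fun x hx => ?_)
    obtain ⟨z, hz, h⟩ := mem_fatten.1 hx
    exact mem_fatten.2 ⟨z, hz, h.trans (by push_cast; linarith)⟩

theorem isSelfAdjoint_annular (Z : Finset Λ) {X : Op q} (hX : IsSelfAdjoint X) (n : ℕ) :
    IsSelfAdjoint (annular Z X n) := by
  cases n with
  | zero => exact isSelfAdjoint_localize _ hX
  | succ n =>
    exact IsSelfAdjoint.sub (R := Op q) (isSelfAdjoint_localize _ hX) (isSelfAdjoint_localize _ hX)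

theorem continuous_annular (Z : Finset Λ) (n : ℕ) :
    Continuous fun X : Op q => annular Z X n := by
  cases n with
  | zero => exact continuous_localize _
  | succ n => exact (continuous_localize _).sub (continuous_localize _)

theorem sum_annular (Z : Finset Λ) (X : Op q) (N : ℕ) :
    ∑ n ∈ Finset.range (N + 1), annular Z X n = localize (fatten Z N) X := by
  induction N with
  | zero => simp [annular]
  | succ N ih => rw [Finset.sum_range_succ, ih, annular, add_sub_cancel]

theorem sum_annular_eq_self {Z : Finset Λ} (hZ : Z.Nonempty) (X : Op q) {N : ℕ}
    (hN : ∀ x y : Λ, dist x y ≤ N) :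
    ∑ n ∈ Finset.range (N + 1), annular Z X n = X := by
  have h : fatten Z N = Finset.univ := by
    obtain ⟨z, hz⟩ := hZ
    exact Finset.eq_univ_of_forall fun x => mem_fatten.2 ⟨z, hz, hN x z⟩
  rw [sum_annular, h, localize_univ]

theorem norm_annular_le {Z : Finset Λ} (hZ : Z.Nonempty) {X : Op q} {c c₀ M : ℝ} {k : ℕ}
    (hc : 0 ≤ c) (hc₀ : 0 ≤ c₀) (hM : 0 ≤ M) (hX : ‖X‖ ≤ c₀ * M)
    (h : ∀ (B : Finset Λ) (P : Op q), SupportedOn B P → ‖⁅X, P⁆‖ ≤ c / (1 + setDist Z B) ^ k * (M * ‖P‖)) (n : ℕ) :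
    ‖annular Z X n‖ ≤ (c₀ + 2 ^ (k + 1) * c) * M * ((1 + (n : ℝ)) ^ k)⁻¹ := by
  have herr : ∀ n : ℕ, ‖localize (fatten Z n) X - X‖ ≤ c / (1 + (n : ℝ)) ^ k * M := by
    intro n
    refine norm_localize_sub_self_le fun P hP hP1 => ?_
    rcases (fatten Z n)ᶜ.eq_empty_or_nonempty with he | hne
    · rw [(supportedOn_univ X).lie_eq_zero hP (he ▸ Finset.disjoint_empty_right _), norm_zero]
      positivity
    · refine (h _ P hP).trans ?_
      have hd : (n : ℝ) ≤ setDist Z (fatten Z n)ᶜ := le_setDist hZ hne fun z hz y hy => by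
        rw [Finset.mem_compl, mem_fatten] at hy
        push Not at hy
        rw [dist_comm]
        exact (hy z hz).le
      have h1 : M * ‖P‖ ≤ M := mul_le_of_le_one_right hM hP1
      gcongr
  cases n with
  | zero =>
    have h1 : 0 ≤ 2 ^ (k + 1) * c * M := by positivity
    calc ‖annular Z X 0‖ ≤ ‖X‖ := norm_localize_le _ _
      _ ≤ c₀ * M := hX
      _ ≤ (c₀ + 2 ^ (k + 1) * c) * M := by linarith
      _ = _ := by simp
  | succ n =>
    have e : annular Z X (n + 1) =
        (localize (fatten Z (n + 1)) X - X) - (localize (fatten Z n) X - X) := by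
      rw [annular]
      abel
    have h2 : c / (1 + ((n + 1 : ℕ) : ℝ)) ^ k ≤ 2 ^ k * c * ((1 + ((n + 1 : ℕ) : ℝ)) ^ k)⁻¹ := by
      rw [div_eq_mul_inv]
      refine mul_le_mul_of_nonneg_right ?_ (by positivity)
      exact le_mul_of_one_le_left hc (one_le_pow₀ one_le_two)
    have h3 : c / (1 + (n : ℝ)) ^ k ≤ 2 ^ k * c * ((1 + ((n + 1 : ℕ) : ℝ)) ^ k)⁻¹ := by
      rw [← div_eq_mul_inv, div_le_div_iff₀ (by positivity) (by positivity), mul_comm (2 ^ k) c,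
        mul_assoc, ← mul_pow]
      refine mul_le_mul_of_nonneg_left (pow_le_pow_left₀ (by positivity) ?_ k) hc
      push_cast
      linarith [(Nat.cast_nonneg n : (0 : ℝ) ≤ n)]
    have h4 : 0 ≤ c₀ * M * ((1 + ((n + 1 : ℕ) : ℝ)) ^ k)⁻¹ := by positivity
    have h5 := (mul_le_mul_of_nonneg_right h2 hM)
    have h6 := (mul_le_mul_of_nonneg_right h3 hM)
    rw [e]
    refine (norm_sub_le _ _).trans ((add_le_add (herr _) (herr _)).trans ?_)
    rw [pow_succ]
    linarith

/-- Summability of the annular parts: an interaction with exponential decay whose terms are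
spread out with polynomial tails decays polynomially. -/
theorem exists_sum_annular_decay (D : ℕ) (κ : ℝ) {μ J : ℝ} (hμ : 0 < μ) (hJ : 0 ≤ J) (p : ℕ) :
    ∃ c, 0 ≤ c ∧ ∀ (Λ : Type*) [Fintype Λ] [DecidableEq Λ] [MetricSpace Λ], HasDimension Λ D κ →
      ∀ f : Finset Λ → ℝ, (∀ Z, 0 ≤ f Z) →
      (∀ u : Λ, ∑ Z with u ∈ Z, f Z * Z.card * Real.exp (μ * Metric.diam (Z : Set Λ)) ≤ J) →
      ∀ (N : ℕ) (x y : Λ),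
        ∑ i : Finset Λ × Fin N with x ∈ fatten i.1 i.2 ∧ y ∈ fatten i.1 i.2,
          f i.1 * i.1.card * ((1 + (i.2 : ℝ)) ^ (p + (D + 2)))⁻¹ ≤
        c * ((1 + dist x y) ^ p)⁻¹ := by
  obtain ⟨c₁, hc₁, hexp⟩ := exists_one_add_pow_le_exp hμ p
  obtain ⟨c₂, hc₂, hsq⟩ := exists_sum_inv_sq_le
  refine ⟨c₁ * 2 ^ p * (J * |κ| * c₂), by positivity, ?_⟩
  intro Λ _ _ _ hdim f hf hfJ N x y
  rw [abs_of_nonneg (hdim.nonneg x)]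
  set w : Finset Λ → ℝ := fun Z => f Z * Z.card * Real.exp (μ * Metric.diam (Z : Set Λ)) with hw
  have hw0 : ∀ Z, 0 ≤ w Z := fun Z => by have := hf Z; positivity
  rw [← div_eq_mul_inv, le_div_iff₀ (by positivity), Finset.sum_mul]
  calc ∑ i : Finset Λ × Fin N with x ∈ fatten i.1 i.2 ∧ y ∈ fatten i.1 i.2,
        f i.1 * i.1.card * ((1 + (i.2 : ℝ)) ^ (p + (D + 2)))⁻¹ * (1 + dist x y) ^ p
      ≤ ∑ i : Finset Λ × Fin N with x ∈ fatten i.1 i.2 ∧ y ∈ fatten i.1 i.2,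
        c₁ * 2 ^ p * (w i.1 * ((1 + (i.2 : ℝ)) ^ (D + 2))⁻¹) := by
        refine Finset.sum_le_sum fun i hi => ?_
        obtain ⟨hx, hy⟩ := (Finset.mem_filter.1 hi).2
        obtain ⟨z, hz, hxz⟩ := mem_fatten.1 hx
        obtain ⟨z', hz', hyz⟩ := mem_fatten.1 hy
        have hzz : dist z z' ≤ Metric.diam (i.1 : Set Λ) :=
          Metric.dist_le_diam_of_mem i.1.finite_toSet.isBounded (by exact_mod_cast hz)
            (by exact_mod_cast hz')
        have hdiam : 0 ≤ Metric.diam (i.1 : Set Λ) := Metric.diam_nonneg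
        set n : ℝ := (i.2 : ℝ)
        have hn : 0 ≤ n := Nat.cast_nonneg _
        have hd : 1 + dist x y ≤ 2 * (1 + n) * (1 + Metric.diam (i.1 : Set Λ)) := by
          have h1 := dist_triangle4 x z z' y
          rw [dist_comm z' y] at h1
          nlinarith
        have hdp : (1 + dist x y) ^ p ≤ 2 ^ p * (1 + n) ^ p *
            (c₁ * Real.exp (μ * Metric.diam (i.1 : Set Λ))) := by
          refine (pow_le_pow_left₀ (by positivity) hd p).trans ?_
          rw [mul_pow, mul_pow]
          exact mul_le_mul_of_nonneg_left (hexp _ hdiam) (by positivity)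
        have hfi := hf i.1
        refine (mul_le_mul_of_nonneg_left hdp (by positivity)).trans_eq ?_
        rw [hw, pow_add]
        field_simp
    _ ≤ ∑ i : Finset Λ × Fin N with x ∈ fatten i.1 i.2,
        c₁ * 2 ^ p * (w i.1 * ((1 + (i.2 : ℝ)) ^ (D + 2))⁻¹) := by
        refine Finset.sum_le_sum_of_subset_of_nonneg (fun i hi => ?_) fun i _ _ => ?_
        · exact Finset.mem_filter.2 ⟨Finset.mem_univ _, (Finset.mem_filter.1 hi).2.1⟩
        · have := hw0 i.1
          positivity
    _ = c₁ * 2 ^ p * ∑ n : Fin N, (∑ Z with x ∈ fatten Z n, w Z) *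
          ((1 + (n : ℝ)) ^ (D + 2))⁻¹ := by
        rw [← Finset.mul_sum, Finset.sum_filter, Fintype.sum_prod_type_right]
        simp only [Finset.sum_filter, Finset.sum_mul, ite_mul, zero_mul]
    _ ≤ c₁ * 2 ^ p * ∑ n : Fin N, J * κ * ((1 + (n : ℝ)) ^ 2)⁻¹ := by
        refine mul_le_mul_of_nonneg_left (Finset.sum_le_sum fun n _ => ?_) (by positivity)
        have h1 : ∑ Z with x ∈ fatten Z n, w Z ≤ κ * (1 + (n : ℝ)) ^ D * J := by
          set ball : Finset Λ := Finset.univ.filter fun v => dist x v ≤ (n : ℝ) with hball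
          have e : (Finset.univ.filter fun Z : Finset Λ => x ∈ fatten Z n) =
              Finset.univ.filter fun Z : Finset Λ => ¬Disjoint Z ball := by
            ext Z
            simp [mem_fatten, Finset.not_disjoint_iff, hball]
          rw [e]
          refine (sum_not_disjoint_le (fun Z => Z) hw0 ball).trans ?_
          refine (Finset.sum_le_card_nsmul _ _ J fun v _ => hfJ v).trans ?_
          rw [nsmul_eq_mul]
          exact mul_le_mul_of_nonneg_right (hdim.card_le x (by positivity)) hJ
        refine (mul_le_mul_of_nonneg_right h1 (by positivity)).trans_eq ?_
        rw [pow_add]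
        field_simp
    _ ≤ c₁ * 2 ^ p * (J * κ * c₂) := by
        have hκ := hdim.nonneg x
        rw [← Finset.mul_sum, Fin.sum_univ_eq_sum_range (fun n : ℕ => ((1 + (n : ℝ)) ^ 2)⁻¹)]
        exact mul_le_mul_of_nonneg_left
          (mul_le_mul_of_nonneg_left (hsq N) (by positivity)) (by positivity)

end Annular

/-! ### Locality of the quasi-adiabatic continuation -/

section Continuation

theorem continuous_generator {Λ : Type*} [Fintype Λ] [DecidableEq Λ] {q : Λ → ℕ} {F : ℝ → ℂ}
    (hF : Integrable F) {H₀ V : Finset Λ → Op q} (hH : IsSelfAdjoint (∑ Z, H₀ Z))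
    (hV : IsSelfAdjoint (∑ Z, V Z)) : Continuous (generator F (path H₀ V)) := by
  rw [funext fun s => generator_eq_dressed F H₀ V s]
  exact continuous_dressed hF (isSelfAdjoint_path hH hV) (continuous_path H₀ V) _

theorem isSelfAdjoint_generator {Λ : Type*} [Fintype Λ] [DecidableEq Λ] {q : Λ → ℕ} {F : ℝ → ℂ}
    (hF : IsFilterFunction F) {H₀ V : Finset Λ → Op q} (hH : IsSelfAdjoint (∑ Z, H₀ Z))
    (hV : IsSelfAdjoint (∑ Z, V Z)) (s : ℝ) : IsSelfAdjoint (generator F (path H₀ V) s) := by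
  rw [generator_eq_dressed]
  exact isSelfAdjoint_dressed hF (isSelfAdjoint_path hH hV s) hV

theorem continuation_mem_unitary {Λ : Type*} [Fintype Λ] [DecidableEq Λ] {q : Λ → ℕ} {F : ℝ → ℂ}
    (hF : IsFilterFunction F) {H₀ V : Finset Λ → Op q} (hH : IsSelfAdjoint (∑ Z, H₀ Z))
    (hV : IsSelfAdjoint (∑ Z, V Z)) (s : ℝ) : continuation F H₀ V s ∈ unitary (Op q) :=
  orderedExp_mem_unitary (continuous_generator hF.integrable hH hV)
    (isSelfAdjoint_generator hF hH hV) s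

theorem mul_comm_of_supportedOn_empty {Λ : Type*} [Fintype Λ] [DecidableEq Λ] {q : Λ → ℕ}
    {X : Op q} (hX : SupportedOn ∅ X) (Y : Op q) : X * Y = Y * X :=
  hX.mul_comm (supportedOn_univ Y) (Finset.disjoint_empty_left _)

theorem annular_zero {Λ : Type*} [Fintype Λ] [DecidableEq Λ] [MetricSpace Λ] {q : Λ → ℕ}
    (Z : Finset Λ) (n : ℕ) : annular Z (0 : Op q) n = 0 := by
  have h : ∀ A : Finset Λ, localize A (0 : Op q) = 0 := fun A =>
    norm_le_zero_iff.1 ((norm_localize_le A (0 : Op q)).trans_eq norm_zero)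
  cases n with
  | zero => exact h _
  | succ n => rw [annular, h, h, sub_self]

/-- The annular parts of the terms of the generator decay faster than any power. -/
theorem exists_norm_annular_dressed_le {F : ℝ → ℂ} (hF : IsFilterFunction F) {μ J K : ℝ}
    (hμ : 0 < μ) (hJ : 0 ≤ J) (hK : 0 ≤ K) (k : ℕ) :
    ∃ c, 0 ≤ c ∧ ∀ (Λ : Type*) [Fintype Λ] [DecidableEq Λ] [MetricSpace Λ] (q : Λ → ℕ)
      (H₀ V : Finset Λ → Op q), IsLocalDecomposition μ K H₀ → IsLocalDecomposition μ J V →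
      ∀ s ∈ Set.Icc (0 : ℝ) 1, ∀ (Z : Finset Λ) (n : ℕ),
        ‖annular Z (dressed F (path H₀ V s) (V Z)) n‖ ≤
          c * (‖V Z‖ * Z.card * ((1 + (n : ℝ)) ^ k)⁻¹) := by
  obtain ⟨c₁, hc₁, hloc⟩ := exists_norm_lie_dressed_le hF hμ (add_nonneg hK hJ) k
  have hF0 : 0 ≤ ∫ t, ‖F t‖ := integral_nonneg fun t => norm_nonneg _
  refine ⟨(∫ t, ‖F t‖) + 2 ^ (k + 1) * c₁, by positivity, ?_⟩
  intro Λ _ _ _ q H₀ V hH hV s hs Z n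
  have hsa := isSelfAdjoint_path hH.selfAdjoint hV.selfAdjoint s
  rcases Z.eq_empty_or_nonempty with rfl | hZ
  · rw [dressed_eq_zero_of_commute hF hsa (mul_comm_of_supportedOn_empty (hV.supported ∅)),
      annular_zero, norm_zero]
    positivity
  · have hZ1 : (1 : ℝ) ≤ Z.card := by exact_mod_cast hZ.card_pos
    have hpath := hH.path (abs_le.2 ⟨by linarith [hs.1], hs.2⟩) hV
    refine (norm_annular_le hZ hc₁ hF0 (M := ‖V Z‖ * Z.card) (k := k) (by positivity) ?_
      (fun B P hP => ?_) n).trans_eq (by ring)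
    · refine (norm_dressed_le hsa (V Z)).trans (mul_le_mul_of_nonneg_left ?_ hF0)
      exact le_mul_of_one_le_right (norm_nonneg _) hZ1
    · have h := hloc Λ q _ hpath Z B (V Z) P (hV.supported Z) hP
      rw [← path_eq_sum] at h
      exact h.trans_eq (by ring)

/-- Lieb-Robinson bound for the quasi-adiabatic continuation with polynomial weights of any
order, for a perturbation with self-adjoint terms. -/
theorem exists_norm_lie_continuation_le {F : ℝ → ℂ} (hF : IsFilterFunction F) (D : ℕ)
    {κ μ J K : ℝ} (hμ : 0 < μ) (hJ : 0 ≤ J) (hK : 0 ≤ K) {p : ℕ} (hp : D + 2 ≤ p) :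
    ∃ c, 0 ≤ c ∧ ∀ (Λ : Type*) [Fintype Λ] [DecidableEq Λ] [MetricSpace Λ], HasDimension Λ D κ →
      ∀ (q : Λ → ℕ) (H₀ V : Finset Λ → Op q), IsLocalDecomposition μ K H₀ →
      IsLocalDecomposition μ J V → (∀ Z, IsSelfAdjoint (V Z)) → ∀ s ∈ Set.Icc (0 : ℝ) 1,
      ∀ (A B : Finset Λ) (O P : Op q), SupportedOn A O → SupportedOn B P →
        ‖⁅star (continuation F H₀ V s) * O * continuation F H₀ V s, P⁆‖ ≤
          c * polyWeight p B A * ‖O‖ * ‖P‖ := by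
  obtain ⟨c₁, hc₁, hann⟩ := exists_norm_annular_dressed_le hF hμ hJ hK (p + (D + 2))
  obtain ⟨c₂, hc₂, hdecay⟩ := exists_sum_annular_decay D κ hμ hJ p
  obtain ⟨S, hS0, hS⟩ := exists_sum_inv_pow_le D κ
  set C : ℝ := c₁ * c₂ * (2 ^ (p + 1) * S) with hC
  have hC0 : 0 ≤ C := by positivity
  refine ⟨4 * Real.exp (4 * C), by positivity, ?_⟩
  intro Λ _ _ _ hdim q H₀ V hH hV hVsa s hs A B O P hO hP
  have hw := polyWeight_nonneg p A B
  rcases B.eq_empty_or_nonempty with rfl | hB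
  · rw [(supportedOn_univ _).lie_eq_zero hP (Finset.disjoint_empty_right _), norm_zero]
    positivity
  have hsa := isSelfAdjoint_path hH.selfAdjoint hV.selfAdjoint
  -- Beyond distance `N` the fattenings exhaust the lattice.
  obtain ⟨N, hN⟩ : ∃ N : ℕ, ∀ x y : Λ, dist x y ≤ N := by
    obtain ⟨N, hN⟩ := exists_nat_ge (Metric.diam (Set.univ : Set Λ))
    exact ⟨N, fun x y => (Metric.dist_le_diam_of_mem Set.finite_univ.isBounded
      (Set.mem_univ x) (Set.mem_univ y)).trans hN⟩
  set Φ : ℝ → Finset Λ × Fin (N + 1) → Op q := fun s i =>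
    annular i.1 (dressed F (path H₀ V s) (V i.1)) i.2 with hΦ
  have hsum : ∀ s, ∑ i, Φ s i = generator F (path H₀ V) s := by
    intro s
    rw [generator_eq_dressed, dressed_sum hF.integrable (hsa s), Fintype.sum_prod_type]
    refine Finset.sum_congr rfl fun Z _ => ?_
    rw [hΦ]
    simp only
    rw [Fin.sum_univ_eq_sum_range
      (fun n => annular Z (dressed F (path H₀ V s) (V Z)) n) (N + 1)]
    rcases Z.eq_empty_or_nonempty with rfl | hZ
    · rw [dressed_eq_zero_of_commute hF (hsa s) (mul_comm_of_supportedOn_empty (hV.supported ∅))]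
      exact Finset.sum_eq_zero fun n _ => annular_zero _ _
    · exact sum_annular_eq_self hZ _ hN
  have hgen := continuous_generator hF.integrable hH.selfAdjoint hV.selfAdjoint
  have hU : ∀ s, HasDerivAt (continuation F H₀ V)
      (Complex.I • ((∑ i, Φ s i) * continuation F H₀ V s)) s := fun s => by
    rw [hsum]
    exact hasDerivAt_orderedExp hgen s
  have hG : ∀ s ∈ Set.Icc (0 : ℝ) 1, ∀ A,
      ∑ i with ¬Disjoint (fatten i.1 i.2) A, ‖Φ s i‖ * polyWeight p B (fatten i.1 i.2) ≤
        C * polyWeight p B A := by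
    intro s hs A
    refine sum_mul_polyWeight_le (hS Λ hdim) hp (fun i : Finset Λ × Fin (N + 1) => fatten i.1 i.2)
      (fun i => norm_nonneg (Φ s i)) (by positivity) (fun x z => ?_) A B
    calc ∑ i with x ∈ fatten i.1 i.2 ∧ z ∈ fatten i.1 i.2, ‖Φ s i‖
        ≤ ∑ i : Finset Λ × Fin (N + 1) with x ∈ fatten i.1 i.2 ∧ z ∈ fatten i.1 i.2,
            c₁ * (‖V i.1‖ * i.1.card * ((1 + (i.2 : ℝ)) ^ (p + (D + 2)))⁻¹) :=
          Finset.sum_le_sum fun i _ => hann Λ q H₀ V hH hV s hs i.1 i.2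
      _ ≤ c₁ * (c₂ * ((1 + dist x z) ^ p)⁻¹) := by
          rw [← Finset.mul_sum]
          exact mul_le_mul_of_nonneg_left (hdecay Λ hdim (fun Z => ‖V Z‖)
            (fun Z => norm_nonneg _) hV.decay (N + 1) x z) hc₁
      _ = c₁ * c₂ * ((1 + dist x z) ^ p)⁻¹ := by ring
  have key := lieb_robinson (supp := fun i : Finset Λ × Fin (N + 1) => fatten i.1 i.2) (Φ := Φ)
    (T := 1) (U := continuation F H₀ V)
    (fun i => (continuous_annular i.1 i.2).comp
      (continuous_dressed hF.integrable hsa (continuous_path H₀ V) (V i.1)))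
    (fun s i => isSelfAdjoint_annular _ (isSelfAdjoint_dressed hF (hsa s) (hVsa i.1)) _)
    (fun s i => supportedOn_annular _ _ _) hU (orderedExp_zero _) hP
    (fun A => polyWeight_nonneg p A B)
    (fun A hA => Finset.sum_pos (fun x _ => Finset.sum_pos (fun y _ => by positivity) hB) hA)
    (fun A hA => ?_) hC0 hG hO hs
  · refine key.trans ?_
    have h1 : Real.exp (4 * C * s) ≤ Real.exp (4 * C) :=
      Real.exp_le_exp.2 (mul_le_of_le_one_right (by positivity) hs.2)
    gcongr
  · obtain ⟨x, hxA, hxB⟩ := Finset.not_disjoint_iff.1 hA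
    calc (1 : ℝ) = ((1 + dist x x) ^ p)⁻¹ := by simp
      _ ≤ ∑ y ∈ B, ((1 + dist x y) ^ p)⁻¹ :=
        Finset.single_le_sum (f := fun y => ((1 + dist x y) ^ p)⁻¹) (fun y _ => by positivity) hxB
      _ ≤ polyWeight p B A :=
        Finset.single_le_sum (f := fun x => ∑ y ∈ B, ((1 + dist x y) ^ p)⁻¹)
          (fun x _ => Finset.sum_nonneg fun y _ => by positivity) hxA

/-- Both Heisenberg evolutions under the continuation are local up to tails that decay like any
given power of the distance. -/
theorem exists_norm_lie_continuation_conj_le {F : ℝ → ℂ} (hF : IsFilterFunction F) (D : ℕ)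
    (κ : ℝ) {μ J K : ℝ} (hμ : 0 < μ) (hJ : 0 ≤ J) (hK : 0 ≤ K) (m : ℕ) :
    ∃ c, 0 ≤ c ∧ ∀ (Λ : Type*) [Fintype Λ] [DecidableEq Λ] [MetricSpace Λ], HasDimension Λ D κ →
      ∀ (q : Λ → ℕ) (H₀ V : Finset Λ → Op q), IsLocalDecomposition μ K H₀ →
      IsLocalDecomposition μ J V → ∀ s ∈ Set.Icc (0 : ℝ) 1,
      ∀ (A B : Finset Λ) (O P : Op q), SupportedOn A O → SupportedOn B P →
        ‖⁅continuation F H₀ V s * O * star (continuation F H₀ V s), P⁆‖ ≤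
          c / (1 + setDist A B) ^ m * (A.card * ‖O‖ * ‖P‖) ∧
        ‖⁅star (continuation F H₀ V s) * O * continuation F H₀ V s, P⁆‖ ≤
          c / (1 + setDist A B) ^ m * (A.card * ‖O‖ * ‖P‖) := by
  obtain ⟨c, hc, hU⟩ := exists_norm_lie_continuation_le hF D (κ := κ) hμ hJ hK
    (Nat.le_add_left (D + 2) m)
  obtain ⟨S, hS0, hS⟩ := exists_sum_inv_pow_le D κ
  refine ⟨c * S, by positivity, ?_⟩
  intro Λ _ _ _ hdim q H₀ V hH hV s hs A B O P hO hP
  obtain ⟨W, hWsupp, hWsa, hWsum, hWnorm⟩ := exists_selfAdjoint_terms hV.supported hV.selfAdjoint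
  have hW : IsLocalDecomposition μ J W :=
    ⟨hWsupp, hWsum ▸ hV.selfAdjoint, fun u => (Finset.sum_le_sum fun Z _ => by
      gcongr
      exact hWnorm Z).trans (hV.decay u)⟩
  have hcont : continuation F H₀ V = continuation F H₀ W := by
    funext s
    have : path H₀ V = path H₀ W := by
      funext s
      rw [path, path, hWsum]
    rw [continuation, continuation, this]
  have hUu := continuation_mem_unitary hF hH.selfAdjoint hW.selfAdjoint s
  rw [hcont]
  have hfin : c * polyWeight (m + (D + 2)) B A * ‖O‖ * ‖P‖ ≤
      c * S / (1 + setDist A B) ^ m * (A.card * ‖O‖ * ‖P‖) := by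
    have h1 := mul_le_mul_of_nonneg_left (polyWeight_le (hS Λ hdim) m A B)
      (by positivity : 0 ≤ c * (‖O‖ * ‖P‖))
    calc _ = c * (‖O‖ * ‖P‖) * polyWeight (m + (D + 2)) B A := by ring
      _ ≤ _ := h1
      _ = _ := by ring
  refine ⟨le_trans ?_ hfin, (hU Λ hdim q H₀ W hH hW hWsa s hs A B O P hO hP).trans hfin⟩
  -- The weight is symmetric, so the conjugation may be moved to the other operator.
  have h2 := hU Λ hdim q H₀ W hH hW hWsa s hs B A P O hP hO
  set U := continuation F H₀ W s
  have h3 : ⁅U * O * star U, P⁆ = U * -⁅star U * P * U, O⁆ * star U := by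
    have h4 : U * star U = 1 := Unitary.mul_star_self_of_mem hUu
    simp only [Ring.lie_def, neg_sub, mul_sub, sub_mul]
    congr 1
    · calc U * O * star U * P = U * O * star U * P * (U * star U) := by rw [h4, mul_one]
        _ = _ := by simp only [mul_assoc]
    · calc P * (U * O * star U) = (U * star U) * P * (U * O * star U) := by rw [h4, one_mul]
        _ = _ := by simp only [mul_assoc]
  rw [h3, norm_mul_mul_star hUu, norm_neg, polyWeight_comm]
  exact h2.trans_eq (by ring)

/-- A family of polynomial bounds of all orders is dominated by a single function that decays
faster than any power. -/
theorem exists_superpolynomialDecay {c : ℕ → ℝ} (hc : ∀ n, 0 ≤ c n) :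
    ∃ h : ℝ → ℝ, Asymptotics.SuperpolynomialDecay atTop (fun l : ℝ => l) h ∧
      ∀ l a M : ℝ, 0 ≤ M → (∀ n, a ≤ c n / (1 + |l|) ^ n * M) → a ≤ h l * M := by
  have hnn : ∀ (l : ℝ) (n : ℕ), 0 ≤ c n / (1 + |l|) ^ n := fun l n => by
    have := hc n
    positivity
  have hbdd : ∀ l : ℝ, BddBelow (Set.range fun n => c n / (1 + |l|) ^ n) := fun l =>
    ⟨0, by rintro _ ⟨n, rfl⟩; exact hnn l n⟩
  refine ⟨fun l => ⨅ n, c n / (1 + |l|) ^ n, fun n => ?_, fun l a M hM h => ?_⟩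
  · have hlim : Tendsto (fun l : ℝ => c (n + 1) / (1 + l)) atTop (nhds 0) :=
      tendsto_const_nhds.div_atTop (tendsto_atTop_add_const_left _ _ tendsto_id)
    refine tendsto_of_tendsto_of_tendsto_of_le_of_le' tendsto_const_nhds hlim ?_ ?_
    · filter_upwards [eventually_ge_atTop 0] with l hl
      exact mul_nonneg (pow_nonneg hl n) (Real.iInf_nonneg fun n => hnn l n)
    · filter_upwards [eventually_ge_atTop 0] with l hl
      refine (mul_le_mul_of_nonneg_left (ciInf_le (hbdd l) (n + 1)) (pow_nonneg hl n)).trans ?_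
      rw [abs_of_nonneg hl, ← mul_div_assoc, div_le_div_iff₀ (by positivity) (by positivity)]
      have h1 : l ^ n ≤ (1 + l) ^ n := pow_le_pow_left₀ hl (by linarith) n
      have h2 := mul_le_mul_of_nonneg_right h1 (mul_nonneg (hc (n + 1)) (by linarith : 0 ≤ 1 + l))
      calc l ^ n * c (n + 1) * (1 + l) ≤ (1 + l) ^ n * (c (n + 1) * (1 + l)) := by linarith
        _ = _ := by ring
  · rw [Real.iInf_mul_of_nonneg hM]
    exact le_ciInf h

end Continuation

end QuasiAdiabatic

end

theorem mainTheorem6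
    (F : ℝ → ℂ) (hF : QuasiAdiabatic.IsFilterFunction F)
    (D : ℕ) (κ μ J K : ℝ) (hμ : 0 < μ) (hJ : 0 < J) (hK : 0 < K) :
    ∃ (C : ℝ) (h h' : ℝ → ℝ),
      Asymptotics.SuperpolynomialDecay atTop (fun l : ℝ => l) h ∧
      Asymptotics.SuperpolynomialDecay atTop (fun l : ℝ => l) h' ∧
      ∀ (Λ : Type*) [Fintype Λ] [DecidableEq Λ] [MetricSpace Λ],
        QuasiAdiabatic.HasDimension Λ D κ →
      ∀ (q : Λ → ℕ), (∀ u, 0 < q u) →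
      ∀ (H₀ V : Finset Λ → QuasiAdiabatic.Op q),
        QuasiAdiabatic.IsLocalDecomposition μ K H₀ →
        QuasiAdiabatic.IsLocalDecomposition μ J V →
      ∀ s ∈ Set.Icc (0 : ℝ) 1,
        (∀ (A B : Finset Λ) (O_A O_B : QuasiAdiabatic.Op q),
          QuasiAdiabatic.SupportedOn A O_A → QuasiAdiabatic.SupportedOn B O_B →
          ‖⁅QuasiAdiabatic.continuation F H₀ V s * O_A *
              star (QuasiAdiabatic.continuation F H₀ V s), O_B⁆‖
            ≤ h (QuasiAdiabatic.setDist A B) * (A.card : ℝ) * ‖O_A‖ * ‖O_B‖ ∧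
          ‖⁅star (QuasiAdiabatic.continuation F H₀ V s) * O_A *
              QuasiAdiabatic.continuation F H₀ V s, O_B⁆‖
            ≤ h (QuasiAdiabatic.setDist A B) * (A.card : ℝ) * ‖O_A‖ * ‖O_B‖) ∧
        ∃ Dz : Finset Λ → QuasiAdiabatic.Op q,
          QuasiAdiabatic.generator F (QuasiAdiabatic.path H₀ V) s = ∑ Z, Dz Z ∧
          (∀ Z, ‖Dz Z‖ ≤ C * ‖V Z‖) ∧
          ∀ (Z B : Finset Λ) (O_B : QuasiAdiabatic.Op q),
            QuasiAdiabatic.SupportedOn B O_B →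
            ‖⁅Dz Z, O_B⁆‖
              ≤ h' (QuasiAdiabatic.setDist Z B) * (Z.card : ℝ) * ‖V Z‖ * ‖O_B‖ := by
  choose c hc hU using fun m : ℕ =>
    QuasiAdiabatic.exists_norm_lie_continuation_conj_le hF D κ hμ hJ.le hK.le m
  choose c' hc' hD using fun n : ℕ =>
    QuasiAdiabatic.exists_norm_lie_dressed_le hF hμ (add_nonneg hK.le hJ.le) n
  obtain ⟨h, hh, hhb⟩ := QuasiAdiabatic.exists_superpolynomialDecay hc
  obtain ⟨h', hh', hhb'⟩ := QuasiAdiabatic.exists_superpolynomialDecay hc'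
  refine ⟨∫ t, ‖F t‖, h, h', hh, hh', ?_⟩
  intro Λ _ _ _ hdim q _ H₀ V hH hV s hs
  have hsa := QuasiAdiabatic.isSelfAdjoint_path hH.selfAdjoint hV.selfAdjoint s
  have hpath := hH.path (abs_le.2 ⟨by linarith [hs.1], hs.2⟩) hV
  have hassoc : ∀ x y z w : ℝ, x * y * z * w = x * (y * z * w) := fun x y z w => by ring
  refine ⟨fun A B O P hO hP => ?_,
    fun Z => QuasiAdiabatic.dressed F (QuasiAdiabatic.path H₀ V s) (V Z), ?_, fun Z => ?_,
    fun Z B P hP => ?_⟩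
  · have habs := abs_of_nonneg (QuasiAdiabatic.setDist_nonneg A B)
    rw [hassoc (h _)]
    constructor
    · refine hhb _ _ _ (by positivity) fun m => ?_
      rw [habs]
      exact (hU m Λ hdim q H₀ V hH hV s hs A B O P hO hP).1
    · refine hhb _ _ _ (by positivity) fun m => ?_
      rw [habs]
      exact (hU m Λ hdim q H₀ V hH hV s hs A B O P hO hP).2
  · rw [QuasiAdiabatic.generator_eq_dressed, QuasiAdiabatic.dressed_sum hF.integrable hsa]
  · exact QuasiAdiabatic.norm_dressed_le hsa (V Z)
  · rw [hassoc (h' _)]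
    refine hhb' _ _ _ (by positivity) fun n => ?_
    rw [abs_of_nonneg (QuasiAdiabatic.setDist_nonneg Z B), QuasiAdiabatic.path_eq_sum]
    exact hD n Λ q _ hpath Z B (V Z) P (hV.supported Z) hP
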